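/- **Setting.** For each sample size $n$ let $p=p_n$ features be partitioned into $D=D_n$ blocks, where $p_n\to\infty$ as $n\to\infty$. Let $\Sigma$ be a $p\times p$ covariance matrix with $\Sigma_{jj}=1$ for all $j$, and let $\Lambda$ be its block-diagonal part (the entries $\Sigma_{ij}$ with $i,j$ in the same block, and $0$ elsewhere). For $j=1,\dots,p$ let $\xi_j$ maximize $\beta^\top\Sigma\beta/\beta^\top\Lambda\beta$ over all $\beta\in\mathbb R^p$ with $\|\beta\|_2=1$ and $\beta^\top\Lambda\xi_i=0$ for all $i<j$, and let $\rho_j=\xi_j^\top\Sigma\xi_j/\xi_j^\top\Lambda\xi_j$. Let $s=\|\xi_1\|_0$ be the number of nonzero entries of $\xi_1$. Assume that, for constants $M,\gamma,C>0$ and all $n$: 1. every eigenvalue of every diagonal block of $\Lambda$ lies in $[1/M,M]$; 2. $\rho_1\ge 1+C$ and $\rho_1-\rho_2\ge\gamma\rho_1$; 3. $s\ln p/n\to0$ as $n\to\infty$. The data are $n$ independent observations $x_1,\dots,x_n\sim\mathcal N(0,\Sigma)$. Let $\hat\Sigma=\frac1n\sum_i x_ix_i^\top$, let $\hat\Lambda$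 be the block-diagonal part of $\hat\Sigma$, and let $f(\beta)=\beta^\top\hat\Sigma\beta/\beta^\top\hat\Lambda\beta$. **Iterates.** Let $0<c_0<1$, $0<\eta\le\frac{1-c_0}{2M(M+3)}$ and $c_{B_1},c_{B_2}>0$ be constants, and let $1\le L_\infty\le\|\xi_1\|_1$ ($L_\infty$ may depend on $n$). Put $L_0=(1+c_{B_1})\sqrt s$ and $L_t=L_\infty+\bigl(1-c_{B_2}\eta\sqrt{s\ln p/n}\bigr)^t(L_0-L_\infty)$. From an initial guess $\beta_0$, which may depend on the data, let, for all large $n$ and all $t\ge0$, $\beta_{t+1}$ be a minimizer of $\|\beta-\theta_t\|_2^2$ over $\{\beta:\|\beta\|_2=1,\ \|\beta\|_1\le L_{t+1}\}$, where $\theta_t=\beta_t+\frac{\eta}{f(\beta_t)}\bigl(\hat\Sigma-f(\beta_t)\hat\Lambda\bigr)\beta_t$. Write $\delta_t=1-|\beta_t^\top\xi_1|$, $\nu=(1-c_0)\gamma^2/M$ and $$T^*=\max\Bigl\{t:\ L_t-\|\xi_1\|_1\ge\tfrac{4c_{B_2}(1+c_{B_1})}{\nu}\sqrt{s^2\ln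 p/n}\Bigr\}.$$ For $c_2,\tau>0$ define the penalized objective $$\underline f_\tau(\beta)=f(\beta)-\tau\rho_1\sqrt{\tfrac{\ln p}{n}}\Bigl(\|\beta\|_1+\frac{c_2\|\beta\|_1^2}{L_0}\Bigr).$$ **Theorem.** There is a constant $\psi_1>0$, depending only on $(M,\gamma,c_0,\eta,c_{B_1},c_{B_2})$, such that for every constant $c_2>0$ there is a constant $\tau_0>0$, depending only on these constants and $c_2$, such that for every $\tau\ge\tau_0$ there is a constant $\psi_2>0$, depending only on these constants, $c_2$ and $\tau$, with the following property. If the initial guess satisfies $\|\beta_0\|_2=1$, $\|\beta_0\|_1\le L_0$ and $\delta_0\le\psi_1$ with probability tending to $1$, then $$\lim_{n\to\infty}\mathbf P\Bigl(\delta_{t^*}\le\psi_2\,\frac{s\ln p}{n}\Bigr)=1,$$ where $t^*$ is any maximizer of $t\mapsto\underline f_\tau(\beta_t)$ over all iterations $t\ge0$ (if one exists), or over the iterations $0\le t\le N$ of a run stopped at any $N\ge T^*$; the probability is that the bound holds simultaneously for all these maximizers $t^*$. -/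

import Mathlib

open MeasureTheory ProbabilityTheory Filter Topology

namespace MsCCA

noncomputable section

/-- Column vectors of length `p`, with the Euclidean norm. -/
abbrev Vec (p : ℕ) := EuclideanSpace ℝ (Fin p)

/-- The `ℓ₁` norm. -/
def l1 {p : ℕ} (b : Vec p) : ℝ := ∑ j, |b j|

/-- The number of nonzero entries. -/
def l0 {p : ℕ} (b : Vec p) : ℕ := (Finset.univ.filter fun j => b j ≠ 0).card

/-- The quadratic form `bᵀ S b`. -/
def quad {p : ℕ} (S : Matrix (Fin p) (Fin p) ℝ) (b : Vec p) : ℝ :=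
  b.ofLp ⬝ᵥ S.mulVec b.ofLp

/-- The generalized Rayleigh quotient `bᵀ S b / bᵀ L b`. -/
def rayleigh {p : ℕ} (S L : Matrix (Fin p) (Fin p) ℝ) (b : Vec p) : ℝ :=
  quad S b / quad L b

/-- The block-diagonal part of `S`, where feature `j` belongs to block `blk j`. -/
def blockPart {p D : ℕ} (blk : Fin p → Fin D) (S : Matrix (Fin p) (Fin p) ℝ) :
    Matrix (Fin p) (Fin p) ℝ :=
  Matrix.of fun i j => if blk i = blk j then S i j else 0

/-- The diagonal block of `S` of the features in block `d`. -/
def blockOf {p D : ℕ} (blk : Fin p → Fin D) (S : Matrix (Fin p) (Fin p) ℝ) (d : Fin D) :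
    Matrix {j : Fin p // blk j = d} {j : Fin p // blk j = d} ℝ :=
  S.submatrix Subtype.val Subtype.val

/-- Unit vectors `b` with `bᵀ L ξᵢ = 0` for `1 ≤ i < j`. -/
def admissible {p : ℕ} (L : Matrix (Fin p) (Fin p) ℝ) (ξ : ℕ → Vec p) (j : ℕ) : Set (Vec p) :=
  {b | ‖b‖ = 1 ∧ ∀ i ∈ Finset.Ico 1 j, b.ofLp ⬝ᵥ L.mulVec (ξ i).ofLp = 0}

/-- `ξ 1, …, ξ p` are successive maximizers of the Rayleigh quotient (indices start at `1`;
values of `ξ` at other indices are irrelevant). -/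
def IsDirections {p : ℕ} (S L : Matrix (Fin p) (Fin p) ℝ) (ξ : ℕ → Vec p) : Prop :=
  ∀ j ∈ Finset.Icc 1 p, ξ j ∈ admissible L ξ j ∧
    ∀ b ∈ admissible L ξ j, rayleigh S L b ≤ rayleigh S L (ξ j)

/-- The population canonical correlation coefficient `ρ_j` of the `j`-th direction. -/
def corr {p D : ℕ} (blk : Fin p → Fin D) (S : Matrix (Fin p) (Fin p) ℝ) (ξ : ℕ → Vec p)
    (j : ℕ) : ℝ :=
  rayleigh S (blockPart blk S) (ξ j)

/-- The assumptions on the population: standardized covariance matrix, within-block eigenvalues in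
`[1/M, M]`, directions `ξ`, `ρ₁ ≥ 1 + C` and `ρ₁ - ρ₂ ≥ γ ρ₁`. -/
structure IsPopulation {p D : ℕ} (blk : Fin p → Fin D) (S : Matrix (Fin p) (Fin p) ℝ)
    (ξ : ℕ → Vec p) (M γ C : ℝ) : Prop where
  posSemidef : S.PosSemidef
  diag_eq_one : ∀ j, S j j = 1
  block_spectrum : ∀ d, spectrum ℝ (blockOf blk S d) ⊆ Set.Icc (1 / M) M
  directions : IsDirections S (blockPart blk S) ξ
  leading : 1 + C ≤ corr blk S ξ 1
  gap : γ * corr blk S ξ 1 ≤ corr blk S ξ 1 - corr blk S ξ 2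

/-- The empirical covariance matrix `Xᵀ X / n` of mean-zero data. -/
def sampleCov {n p : ℕ} (x : Fin n → Vec p) : Matrix (Fin p) (Fin p) ℝ :=
  Matrix.of fun j k => (∑ i, x i j * x i k) / n

/-- The empirical objective `f(b)`. -/
def objective {n p D : ℕ} (blk : Fin p → Fin D) (x : Fin n → Vec p) (b : Vec p) : ℝ :=
  rayleigh (sampleCov x) (blockPart blk (sampleCov x)) b

/-- The proximal target `θ = b + (η / f(b)) (Σ̂ - f(b) Λ̂) b`. -/
def proxTarget {n p D : ℕ} (blk : Fin p → Fin D) (x : Fin n → Vec p) (η : ℝ) (b : Vec p) :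
    Vec p :=
  b + (η / objective blk x b) •
    WithLp.toLp 2 ((sampleCov x - objective blk x b • blockPart blk (sampleCov x)).mulVec b.ofLp)

/-- Unit vectors of `ℓ₁` norm at most `L`. -/
def feasible (p : ℕ) (L : ℝ) : Set (Vec p) := {b | ‖b‖ = 1 ∧ l1 b ≤ L}

/-- `b` is a sequence of iterates with step size `η` and `ℓ₁` bounds `L`: each `b (t + 1)` is a
(not necessarily unique) point of `feasible p (L (t + 1))` nearest to the proximal target. -/
def IsRun {n p D : ℕ} (blk : Fin p → Fin D) (x : Fin n → Vec p) (η : ℝ) (L : ℕ → ℝ)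
    (b : ℕ → Vec p) : Prop :=
  ∀ t, b (t + 1) ∈ feasible p (L (t + 1)) ∧
    ∀ v ∈ feasible p (L (t + 1)),
      ‖b (t + 1) - proxTarget blk x η (b t)‖ ^ 2 ≤ ‖v - proxTarget blk x η (b t)‖ ^ 2

/-- The rate `s ln p / n`. -/
def rate (s p n : ℕ) : ℝ := s * Real.log p / n

/-- The initial bound `L₀ = (1 + c_{B₁}) √s`. -/
def initBound (cB₁ : ℝ) (s : ℕ) : ℝ := (1 + cB₁) * √(s : ℝ)

/-- The bounds `L_t = L_∞ + (1 - c_{B₂} η √(s ln p / n))ᵗ (L₀ - L_∞)`. -/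
def bound (cB₁ cB₂ η Linf : ℝ) (s p n t : ℕ) : ℝ :=
  Linf + (1 - cB₂ * η * √(rate s p n)) ^ t * (initBound cB₁ s - Linf)

/-- The iteration `T* = max {t : L_t - ‖ξ₁‖₁ ≥ (4 c_{B₂} (1 + c_{B₁}) / ν) √(s² ln p / n)}` with
`ν = (1 - c₀) γ² / M`, where `ℓ = ‖ξ₁‖₁`. When `s ln p / n` is small and positive and `L_∞ ≤ ℓ ≤ √s`,
the set is nonempty and finite, so that the supremum in `ℕ` is a maximum. -/
def lastIter (M γ c₀ cB₁ cB₂ η Linf ℓ : ℝ) (s p n : ℕ) : ℕ :=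
  sSup {t : ℕ | 4 * cB₂ * (1 + cB₁) / ((1 - c₀) * γ ^ 2 / M) *
      √((s : ℝ) ^ 2 * Real.log p / n) ≤ bound cB₁ cB₂ η Linf s p n t - ℓ}

/-- The penalized objective `f(b) - τ ρ₁ √(ln p / n) (‖b‖₁ + c₂ ‖b‖₁² / L₀)`. -/
def penalized {n p D : ℕ} (blk : Fin p → Fin D) (x : Fin n → Vec p) (τ ρ₁ c₂ L₀ : ℝ)
    (b : Vec p) : ℝ :=
  objective blk x b - τ * ρ₁ * √(Real.log p / n) * (l1 b + c₂ * l1 b ^ 2 / L₀)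

/-- The discrepancy `δ = 1 - |bᵀ ξ₁|`. -/
def discrepancy {p : ℕ} (ξ₁ b : Vec p) : ℝ := 1 - |inner ℝ b ξ₁|

end

end MsCCA

/-
With probability at least `1 - 2 / p`, a chi-square tail bound and a union bound over a net make the
sample covariance matrix accurate, up to a relative error of order `e = √(s ln p / n)`, on all
`2 s`-sparse vectors. Polarization and the splitting of a vector into sparse pieces turn this into
`|B' u v - B u v| ≤ e * N u * N v` for all `u` and `v`, with `N u = ‖u‖₂ + ‖u‖₁ / √s`, both for the
covariance form and for its block-diagonal part. From here on everything is deterministic.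

The next iterate is compared with points of the normalized segment from the current iterate to `ξ₁`.
Those are feasible to the extent that the slack of the `ℓ₁` bound, `(L_t - ‖ξ₁‖₁) / √s`, allows a
step along the segment. The gap condition makes the population ascent contract towards `ξ₁`, so the
squared error stays below a fixed multiple of the squared slack as long as the slack dominates `e`.
The slack decreases by at most a multiple of `e` per iteration, so at some iteration up to `T*` both
the error and the excess of the `ℓ₁` norm over `‖ξ₁‖₁` are of order `e`, in units of `1` and `√s`.

A maximizer of the penalized objective is at least as good as that iterate. For a large `τ` the
penalty absorbs the sampling error, as in the analysis of the lasso, and the curvature of the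
population Rayleigh quotient at `ξ₁` leaves a squared error of order `e ^ 2`.
-/

namespace MsCCA

noncomputable section

section Bilinear

variable {E : Type*} [AddCommGroup E] [Module ℝ E] {B : LinearMap.BilinForm ℝ E}

lemma apply_sub_sub (hB : B.IsSymm) (u v : E) :
    B (u - v) (u - v) = B u u - 2 * B u v + B v v := by
  simp only [map_sub, LinearMap.sub_apply, hB.eq v u]
  ring

lemma abs_apply_le_of_apply_self_le (hB : B.IsPosSemidef) {a U V : ℝ} {u v : E} (ha : 0 ≤ a)
    (hU : 0 ≤ U) (hV : 0 ≤ V) (hu : B u u ≤ a * U ^ 2) (hv : B v v ≤ a * V ^ 2) :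
    |B u v| ≤ a * (U * V) := by
  apply abs_le_of_sq_le_sq _ (by positivity)
  calc B u v ^ 2 ≤ B u u * B v v :=
        B.apply_sq_le_of_symm hB.nonneg (LinearMap.BilinForm.isSymm_iff.1 hB.isSymm) u v
    _ ≤ (a * U ^ 2) * (a * V ^ 2) := mul_le_mul hu hv (hB.nonneg v) (by positivity)
    _ = _ := by ring

end Bilinear

section InnerProduct

variable {E : Type*} [NormedAddCommGroup E] [InnerProductSpace ℝ E] {x b u v : E}

lemma inner_sub_self (hb : ‖b‖ = 1) (hx : ‖x‖ = 1) :
    inner ℝ (b - x) x = -‖b - x‖ ^ 2 / 2 := by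
  rw [inner_sub_left, real_inner_self_eq_norm_sq, norm_sub_sq_real b x, hb, hx]
  ring

lemma abs_apply_le_of_abs_apply_self_le {B : LinearMap.BilinForm ℝ E} (hB : B.IsSymm) {a : ℝ}
    (P : Submodule ℝ E) (h : ∀ u ∈ P, |B u u| ≤ a * ‖u‖ ^ 2) (hu : u ∈ P) (hv : v ∈ P) :
    |B u v| ≤ a * (‖u‖ * ‖v‖) := by
  have unit : ∀ x ∈ P, ∀ y ∈ P, ‖x‖ = 1 → ‖y‖ = 1 → |B x y| ≤ a := by
    intro x hx y hy hx1 hy1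
    have hadd := abs_le.1 (h _ (P.add_mem hx hy))
    have hsub := abs_le.1 (h _ (P.sub_mem hx hy))
    have parallelogram := parallelogram_law_with_norm ℝ x y
    simp only [map_add, map_sub, LinearMap.add_apply, LinearMap.sub_apply, hB.eq y x]
      at hadd hsub
    rw [hx1, hy1] at parallelogram
    rw [abs_le]
    constructor <;> nlinarith
  rcases eq_or_ne u 0 with rfl | hu0
  · simp
  rcases eq_or_ne v 0 with rfl | hv0
  · simp
  have : 0 < ‖u‖ := norm_pos_iff.2 hu0
  have : 0 < ‖v‖ := norm_pos_iff.2 hv0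
  have normalized := unit (‖u‖⁻¹ • u) (P.smul_mem _ hu) (‖v‖⁻¹ • v) (P.smul_mem _ hv)
    (norm_smul_inv_norm hu0) (norm_smul_inv_norm hv0)
  simp only [map_smul, LinearMap.smul_apply, smul_eq_mul, abs_mul, abs_inv, abs_norm]
    at normalized
  calc |B u v| = (‖v‖⁻¹ * (‖u‖⁻¹ * |B u v|)) * (‖u‖ * ‖v‖) := by field_simp
    _ ≤ a * (‖u‖ * ‖v‖) := by gcongr

end InnerProduct

section Leading

variable {E : Type*} [NormedAddCommGroup E] [InnerProductSpace ℝ E]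

/-- The unit vector `x` spans the leading generalized eigenspace of the pair of forms `(S, L)`,
where `L` has its eigenvalues in `[1 / M, M]`. The pair is normalized to have leading eigenvalue
`1`, and `γ` is the relative eigengap. -/
structure IsLeading (S L : LinearMap.BilinForm ℝ E) (x : E) (M γ : ℝ) : Prop where
  const_pos : 0 < M
  gap_pos : 0 < γ
  posSemidef : S.IsPosSemidef
  symm : L.IsSymm
  lower : ∀ u, ‖u‖ ^ 2 ≤ M * L u u
  upper : ∀ u, L u u ≤ M * ‖u‖ ^ 2
  norm_eq : ‖x‖ = 1
  eigen : ∀ v, S v x = L v x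
  gap : ∀ w, L w x = 0 → S w w ≤ (1 - γ) * L w w

namespace IsLeading

variable {S L : LinearMap.BilinForm ℝ E} {x b : E} {M γ : ℝ} (h : IsLeading S L x M γ)
include h

lemma mono_gap {γ' : ℝ} (hγ' : 0 < γ') (hle : γ' ≤ γ) : IsLeading S L x M γ' where
  __ := h
  gap_pos := hγ'
  gap w hw := (h.gap w hw).trans (mul_le_mul_of_nonneg_right (by linarith)
    (nonneg_of_mul_nonneg_right ((sq_nonneg _).trans (h.lower w)) h.const_pos))

protected lemma neg : IsLeading S L (-x) M γ :=
  { h with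
    norm_eq := by rw [norm_neg, h.norm_eq]
    eigen := fun v => by simp [h.eigen]
    gap := fun w hw => h.gap w (by simpa using hw) }

lemma posSemidef_right : L.IsPosSemidef where
  eq := h.symm.eq
  nonneg u := nonneg_of_mul_nonneg_right ((sq_nonneg _).trans (h.lower u)) h.const_pos

lemma one_le_mul : 1 ≤ M * L x x := by simpa [h.norm_eq] using h.lower x

lemma deficit_sub_smul (u : E) (a : ℝ) :
    L (u - a • x) (u - a • x) - S (u - a • x) (u - a • x) = L u u - S u u := by
  simp only [apply_sub_sub h.symm, apply_sub_sub h.posSemidef.isSymm, map_smul,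
    LinearMap.smul_apply, h.eigen]
  ring

lemma deficit_sub (u : E) : L (u - x) (u - x) - S (u - x) (u - x) = L u u - S u u := by
  simpa only [one_smul] using h.deficit_sub_smul u 1

lemma exists_gap_le_deficit (u : E) :
    ∃ a : ℝ, γ * L (u - a • x) (u - a • x) ≤ L u u - S u u := by
  have hx : L x x ≠ 0 := fun hx => by simpa [hx] using h.one_le_mul.trans_lt' one_pos
  refine ⟨L u x / L x x, ?_⟩
  rw [← h.deficit_sub_smul u (L u x / L x x)]
  have orthogonal : L (u - (L u x / L x x) • x) x = 0 := by simp [hx]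
  linarith [h.gap _ orthogonal]

lemma apply_self_le (u : E) : S u u ≤ L u u := by
  obtain ⟨a, ha⟩ := h.exists_gap_le_deficit u
  linarith [mul_nonneg h.gap_pos.le (h.posSemidef_right.nonneg (u - a • x))]

lemma abs_left_le (u v : E) : |S u v| ≤ M * (‖u‖ * ‖v‖) :=
  abs_apply_le_of_apply_self_le h.posSemidef h.const_pos.le (norm_nonneg _) (norm_nonneg _)
    ((h.apply_self_le u).trans (h.upper u)) ((h.apply_self_le v).trans (h.upper v))

lemma abs_right_le (u v : E) : |L u v| ≤ M * (‖u‖ * ‖v‖) :=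
  abs_apply_le_of_apply_self_le h.posSemidef_right h.const_pos.le (norm_nonneg _)
    (norm_nonneg _) (h.upper u) (h.upper v)

lemma curvature (hb : ‖b‖ = 1) (hbx : ‖b - x‖ ^ 2 ≤ 2) :
    γ / (2 * M) * ‖b - x‖ ^ 2 ≤ L (b - x) (b - x) - S (b - x) (b - x) := by
  have hM := h.const_pos
  obtain ⟨a, ha⟩ := h.exists_gap_le_deficit (b - x)
  -- `b - x` is almost orthogonal to `x`, so no multiple of `x` comes close to it.
  have far : ‖b - x‖ ^ 2 / 2 ≤ ‖b - x - a • x‖ ^ 2 := by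
    rw [norm_sub_sq_real (b - x) (a • x), inner_smul_right, inner_sub_self hb h.norm_eq,
      norm_smul, h.norm_eq, mul_one, Real.norm_eq_abs, sq_abs]
    nlinarith [sq_nonneg (a + ‖b - x‖ ^ 2 / 2), sq_nonneg ‖b - x‖]
  have lower : ‖b - x‖ ^ 2 / (2 * M) ≤ L (b - x - a • x) (b - x - a • x) := by
    rw [div_le_iff₀ (by positivity)]
    linarith [h.lower (b - x - a • x)]
  calc γ / (2 * M) * ‖b - x‖ ^ 2 = γ * (‖b - x‖ ^ 2 / (2 * M)) := by ring
    _ ≤ _ := (mul_le_mul_of_nonneg_left lower h.gap_pos.le).trans ha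

end IsLeading

end Leading

section Closeness

variable {E : Type*} [NormedAddCommGroup E] [InnerProductSpace ℝ E]

/-- The form `B'` approximates `B` up to `e` relative to the seminorm `N`. -/
def IsClose (N : Seminorm ℝ E) (e : ℝ) (B B' : LinearMap.BilinForm ℝ E) : Prop :=
  ∀ u v, |B' u v - B u v| ≤ e * (N u * N v)

variable {N : Seminorm ℝ E} {S L S' L' : LinearMap.BilinForm ℝ E} {x b : E} {M γ e N₀ : ℝ}

lemma IsClose.smul (h : IsClose N e S S') (a : ℝ) : IsClose N (|a| * e) (a • S) (a • S') :=
  fun u v => by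
    simpa only [LinearMap.smul_apply, smul_eq_mul, ← mul_sub, abs_mul, mul_assoc] using
      mul_le_mul_of_nonneg_left (h u v) (abs_nonneg a)

lemma IsClose.abs_self_le (h : IsClose N e S S') (he : 0 ≤ e) (hN : N b ≤ N₀) :
    |S' b b - S b b| ≤ e * N₀ ^ 2 := by
  refine (h b b).trans ?_
  rw [← pow_two]
  gcongr

namespace IsLeading

variable (h : IsLeading S L x M γ) (hS : IsClose N e S S') (hL : IsClose N e L L')
  (he : 0 ≤ e) (hb : ‖b‖ = 1) (hN : N b ≤ N₀)
  (hsmall : M * ‖b - x‖ ^ 2 + 2 * (e * N₀ ^ 2) ≤ 1 / (2 * M))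
include h hS hL he hb hN hsmall

lemma inv_le_apply_self_of_isClose : 1 / (2 * M) ≤ S' b b ∧ 1 / (2 * M) ≤ L' b b := by
  have hM := h.const_pos
  have hSb := abs_le.1 (hS.abs_self_le he hN)
  have hLb := abs_le.1 (hL.abs_self_le he hN)
  have hL_lower : 1 / M ≤ L b b := by
    have := h.lower b
    rw [hb, one_pow] at this
    rwa [div_le_iff₀' hM]
  have half : 1 / M = 2 * (1 / (2 * M)) := by field_simp
  have hdeficit := h.deficit_sub b
  have hnonneg := h.posSemidef.nonneg (b - x)
  have hupper := h.upper (b - x)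
  have : 0 ≤ M * ‖b - x‖ ^ 2 := by positivity
  have : 0 ≤ e * N₀ ^ 2 := by positivity
  constructor <;> linarith

lemma abs_div_sub_one_le : |L' b b / S' b b - 1| ≤
    2 * M * (M * ‖b - x‖ ^ 2 + 2 * (e * N₀ ^ 2)) := by
  have hM := h.const_pos
  have hS_lower := (h.inv_le_apply_self_of_isClose hS hL he hb hN hsmall).1
  have hS_pos : 0 < S' b b := lt_of_lt_of_le (by positivity) hS_lower
  have hSb := abs_le.1 (hS.abs_self_le he hN)
  have hLb := abs_le.1 (hL.abs_self_le he hN)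
  have hdeficit := h.deficit_sub b
  have hnonneg := h.posSemidef.nonneg (b - x)
  have hupper := h.upper (b - x)
  have htop := h.apply_self_le (b - x)
  have numerator : |L' b b - S' b b| ≤ M * ‖b - x‖ ^ 2 + 2 * (e * N₀ ^ 2) := by
    rw [abs_le]
    constructor <;> linarith
  rw [div_sub_one hS_pos.ne', abs_div, abs_of_pos hS_pos, div_le_iff₀ hS_pos]
  calc |L' b b - S' b b| ≤ M * ‖b - x‖ ^ 2 + 2 * (e * N₀ ^ 2) := numerator
    _ = 2 * M * (M * ‖b - x‖ ^ 2 + 2 * (e * N₀ ^ 2)) * (1 / (2 * M)) := by field_simp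
    _ ≤ _ := by gcongr

lemma abs_gradient_sub_le (v : E) :
    |(L' b b / S' b b * S' v b - L' v b) - (S v b - L v b)| ≤
      2 * M * (M * ‖b - x‖ ^ 2 + 2 * (e * N₀ ^ 2)) * M * ‖v‖ + 3 * e * N₀ * N v := by
  have hM := h.const_pos
  have hq := h.abs_div_sub_one_le hS hL he hb hN hsmall
  set q := L' b b / S' b b
  set φ := 2 * M * (M * ‖b - x‖ ^ 2 + 2 * (e * N₀ ^ 2)) with hφ
  have hφ_le : φ ≤ 1 := by
    calc φ ≤ 2 * M * (1 / (2 * M)) := by rw [hφ]; gcongr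
      _ = 1 := by field_simp
  have hq_le : |q| ≤ 2 := by
    have := abs_le.1 hq
    rw [abs_le]
    constructor <;> linarith
  have hSv : |S v b| ≤ M * ‖v‖ := by simpa [hb] using h.abs_left_le v b
  have hclose : e * (N v * N b) ≤ e * (N v * N₀) := by gcongr
  calc |(q * S' v b - L' v b) - (S v b - L v b)|
      = |(q - 1) * S v b + q * (S' v b - S v b) - (L' v b - L v b)| := by ring_nf
    _ ≤ |(q - 1) * S v b| + |q * (S' v b - S v b)| + |L' v b - L v b| :=
        (abs_sub _ _).trans (by gcongr; exact abs_add_le _ _)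
    _ ≤ φ * (M * ‖v‖) + 2 * (e * (N v * N₀)) + e * (N v * N₀) := by
        rw [abs_mul, abs_mul]
        gcongr
        · exact (hS v b).trans hclose
        · exact (hL v b).trans hclose
    _ = _ := by ring

end IsLeading

end Closeness

section StepForm

variable {E : Type*} [NormedAddCommGroup E] [InnerProductSpace ℝ E]

/-- The population gradient step `1 + η (S - L)`, as a bilinear form. -/
def stepForm (S L : LinearMap.BilinForm ℝ E) (η : ℝ) : LinearMap.BilinForm ℝ E :=
  innerₗ E + η • (S - L)

variable {S L : LinearMap.BilinForm ℝ E} {x b u v : E} {M γ η : ℝ}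

lemma stepForm_apply (u v : E) : stepForm S L η u v = inner ℝ u v + η * (S u v - L u v) := rfl

namespace IsLeading

variable (h : IsLeading S L x M γ)
include h

lemma stepForm_apply_leading (v : E) : stepForm S L η v x = inner ℝ v x := by
  simp [stepForm_apply, h.eigen]

variable (hη : 0 ≤ η)
include hη

lemma isPosSemidef_stepForm (hηM : η * M ≤ 1) : (stepForm S L η).IsPosSemidef where
  eq u v := by
    rw [stepForm_apply, stepForm_apply, real_inner_comm, h.posSemidef.eq u v, h.symm.eq u v]
  nonneg u := by
    have hL := mul_le_mul_of_nonneg_left (h.upper u) hη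
    have hS := mul_nonneg hη (h.posSemidef.nonneg u)
    have hM : η * M * ‖u‖ ^ 2 ≤ 1 * ‖u‖ ^ 2 := by gcongr
    rw [stepForm_apply, real_inner_self_eq_norm_sq]
    linarith

lemma stepForm_apply_le (hηM : η * M ≤ 1) (u v : E) : stepForm S L η u v ≤ ‖u‖ * ‖v‖ := by
  have diag : ∀ w, stepForm S L η w w ≤ 1 * ‖w‖ ^ 2 := fun w => by
    have := mul_nonneg hη (sub_nonneg.2 (h.apply_self_le w))
    rw [stepForm_apply, real_inner_self_eq_norm_sq]
    linarith
  simpa only [one_mul] using (le_abs_self _).trans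
    (abs_apply_le_of_apply_self_le (h.isPosSemidef_stepForm hη hηM) zero_le_one (norm_nonneg _)
      (norm_nonneg _) (diag u) (diag v))

lemma stepForm_sub_apply_sub_le (hηM : η * M ≤ 1) (hκ : η * γ / (2 * M) ≤ 1)
    (hu : ‖u‖ = 1) (hv : ‖v‖ = 1) (hux : ‖u - x‖ ^ 2 ≤ 2) (hvx : ‖v - x‖ ^ 2 ≤ 2) :
    stepForm S L η (u - x) (v - x) ≤ (1 - η * γ / (2 * M)) * (‖u - x‖ * ‖v - x‖) := by
  have diag : ∀ w, ‖w‖ = 1 → ‖w - x‖ ^ 2 ≤ 2 → stepForm S L η (w - x) (w - x) ≤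
      (1 - η * γ / (2 * M)) * ‖w - x‖ ^ 2 := fun w hw hwx => by
    have := mul_le_mul_of_nonneg_left (h.curvature hw hwx) hη
    rw [stepForm_apply, real_inner_self_eq_norm_sq]
    linarith [show η * (γ / (2 * M) * ‖w - x‖ ^ 2) = η * γ / (2 * M) * ‖w - x‖ ^ 2 by ring]
  exact (le_abs_self _).trans
    (abs_apply_le_of_apply_self_le (h.isPosSemidef_stepForm hη hηM) (sub_nonneg.2 hκ)
      (norm_nonneg _) (norm_nonneg _) (diag u hu hux) (diag v hv hvx))

end IsLeading

end StepForm

section L1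

variable {p : ℕ}

lemma l1_nonneg (u : Vec p) : 0 ≤ l1 u := Finset.sum_nonneg fun _ _ => abs_nonneg _

lemma l1_add_le (u v : Vec p) : l1 (u + v) ≤ l1 u + l1 v := by
  simp only [l1, ← Finset.sum_add_distrib]
  exact Finset.sum_le_sum fun j _ => abs_add_le _ _

lemma l1_smul (c : ℝ) (u : Vec p) : l1 (c • u) = |c| * l1 u := by
  simp [l1, Finset.mul_sum, abs_mul]

@[simp] lemma l1_neg (u : Vec p) : l1 (-u) = l1 u := by simp [l1]

@[simp] lemma l0_neg (u : Vec p) : l0 (-u) = l0 u := by simp [l0]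

lemma l0_le (u : Vec p) : l0 u ≤ p := (Finset.card_le_univ _).trans_eq (Fintype.card_fin p)

lemma sum_abs_le (T : Finset (Fin p)) (u : Vec p) : ∑ j ∈ T, |u j| ≤ √(T.card : ℝ) * ‖u‖ := by
  have hT : ∑ j ∈ T, |u j| ^ 2 ≤ ‖u‖ ^ 2 := by
    simp only [EuclideanSpace.norm_sq_eq, Real.norm_eq_abs]
    exact Finset.sum_le_univ_sum_of_nonneg fun _ => sq_nonneg _
  apply le_of_sq_le_sq _ (by positivity)
  rw [mul_pow, Real.sq_sqrt (Nat.cast_nonneg _)]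
  exact sq_sum_le_card_mul_sum_sq.trans (by gcongr)

lemma l1_sub_le (b x : Vec p) : l1 (b - x) ≤ 2 * (√(l0 x : ℝ) * ‖b - x‖) + (l1 b - l1 x) := by
  refine le_trans ?_ (add_le_add_left (mul_le_mul_of_nonneg_left
    (sum_abs_le {j | x j ≠ 0} (b - x)) zero_le_two) _)
  rw [Finset.sum_filter, Finset.mul_sum]
  simp only [l1, ← Finset.sum_sub_distrib, ← Finset.sum_add_distrib]
  refine Finset.sum_le_sum fun j _ => ?_
  by_cases hj : x j = 0
  · simp [hj]
  · simp only [PiLp.sub_apply, ne_eq, hj, not_false_eq_true, if_true]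
    linarith [abs_sub_abs_le_abs_sub (x j) (b j), abs_sub_comm (x j) (b j)]

lemma l1_sub_l1_le (b x : Vec p) : l1 x - l1 b ≤ √(l0 x : ℝ) * ‖b - x‖ := by
  refine le_trans ?_ (sum_abs_le {j | x j ≠ 0} (b - x))
  rw [Finset.sum_filter]
  simp only [l1, ← Finset.sum_sub_distrib]
  refine Finset.sum_le_sum fun j _ => ?_
  by_cases hj : x j = 0
  · simp [hj]
  · simp only [PiLp.sub_apply, ne_eq, hj, not_false_eq_true, if_true]
    linarith [abs_sub_abs_le_abs_sub (x j) (b j), abs_sub_comm (x j) (b j)]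

lemma l1_le_sqrt_l0 (x : Vec p) : l1 x ≤ √(l0 x : ℝ) * ‖x‖ := by
  simpa [l1] using l1_sub_l1_le 0 x

lemma l0_pos {x : Vec p} (hx : x ≠ 0) : 0 < l0 x := by
  obtain ⟨j, hj⟩ : ∃ j, x j ≠ 0 := by
    by_contra! h
    exact hx (PiLp.ext h)
  exact Finset.card_pos.2 ⟨j, by simpa using hj⟩

lemma sqrt_l0_pos {x : Vec p} (hx : ‖x‖ = 1) : 0 < √(l0 x : ℝ) :=
  Real.sqrt_pos.2 (Nat.cast_pos.2 (l0_pos (norm_ne_zero_iff.1 (hx ▸ one_ne_zero))))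

/-- The norm `‖u‖₂ + ‖u‖₁ / √s`, in which vectors with about `s` nonzero entries have size
comparable to their Euclidean norm. -/
def mixedNorm (s : ℕ) : Seminorm ℝ (Vec p) :=
  Seminorm.of (fun u => ‖u‖ + l1 u / √(s : ℝ))
    (fun u v => by
      have := div_le_div_of_nonneg_right (l1_add_le u v) (Real.sqrt_nonneg s)
      linarith [norm_add_le u v, add_div (l1 u) (l1 v) √(s : ℝ)])
    (fun c u => by rw [norm_smul, l1_smul, Real.norm_eq_abs]; ring)

lemma mixedNorm_apply (s : ℕ) (u : Vec p) : mixedNorm s u = ‖u‖ + l1 u / √(s : ℝ) := rfl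

lemma mixedNorm_le {s : ℕ} {u : Vec p} {A : ℝ} (hs : 0 < √(s : ℝ)) (hu : ‖u‖ = 1)
    (hA : l1 u ≤ A * √(s : ℝ)) : mixedNorm s u ≤ 1 + A := by
  rw [mixedNorm_apply, hu]
  gcongr
  rwa [div_le_iff₀ hs]

lemma mixedNorm_l0_self_le {x : Vec p} (hx : ‖x‖ = 1) : mixedNorm (l0 x) x ≤ 2 := by
  have h : l1 x ≤ 1 * √(l0 x : ℝ) := by simpa [hx] using l1_le_sqrt_l0 x
  linarith [mixedNorm_le (sqrt_l0_pos hx) hx h]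

lemma mixedNorm_sub_le {b x : Vec p} (hx : ‖x‖ = 1) :
    mixedNorm (l0 x) (b - x) ≤ 3 * ‖b - x‖ + (l1 b - l1 x) / √(l0 x : ℝ) := by
  have hs := sqrt_l0_pos hx
  have h := div_le_div_of_nonneg_right (l1_sub_le b x) hs.le
  rw [add_div, mul_div_assoc, mul_div_cancel_left₀ _ hs.ne'] at h
  rw [mixedNorm_apply]
  linarith

end L1

section Interpolation

variable {p : ℕ} {b x : Vec p} {a ℓ : ℝ}

lemma sq_norm_segment (hb : ‖b‖ = 1) (hx : ‖x‖ = 1) :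
    ‖(1 - a) • b + a • x‖ ^ 2 = 1 - a * (1 - a) * ‖b - x‖ ^ 2 := by
  rw [norm_add_sq_real, norm_sub_sq_real, norm_smul, norm_smul, inner_smul_left,
    inner_smul_right, hb, hx, Real.norm_eq_abs, Real.norm_eq_abs, mul_one, mul_one, sq_abs, sq_abs]
  simp only [conj_trivial]
  ring

lemma norm_segment_bounds (hb : ‖b‖ = 1) (hx : ‖x‖ = 1) (hbx : ‖b - x‖ ^ 2 ≤ 1) (ha : 0 < a)
    (ha' : a < 1) :
    0 < ‖(1 - a) • b + a • x‖ ∧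
    1 - a * (1 - a) * ‖b - x‖ ^ 2 ≤ ‖(1 - a) • b + a • x‖ ∧
    ‖(1 - a) • b + a • x‖ ≤ 1 - a * (1 - a) * ‖b - x‖ ^ 2 / 2 := by
  have hsq := sq_norm_segment (a := a) hb hx
  set z := (1 - a) • b + a • x
  have : 0 ≤ a * (1 - a) := mul_nonneg ha.le (by linarith)
  have haa : a * (1 - a) ≤ 1 / 4 := by linarith [sq_nonneg (a - 1 / 2)]
  set m := a * (1 - a) * ‖b - x‖ ^ 2
  have hm : 0 ≤ m := by positivity
  have hm' : m ≤ 1 / 4 := by nlinarith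
  have lower : 1 - m ≤ ‖z‖ := le_of_sq_le_sq (by rw [hsq]; nlinarith) (norm_nonneg _)
  exact ⟨by linarith, lower, le_of_sq_le_sq (by rw [hsq]; nlinarith [sq_nonneg m]) (by linarith)⟩

lemma normalized_segment_mem_feasible (hb : b ∈ feasible p ℓ) (hx : ‖x‖ = 1)
    (hbx : ‖b - x‖ ^ 2 ≤ 1) (hslack : ‖b - x‖ ^ 2 * ℓ ≤ ℓ - l1 x) (ha : 0 < a) (ha' : a < 1) :
    ‖(1 - a) • b + a • x‖⁻¹ • ((1 - a) • b + a • x) ∈ feasible p ℓ := by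
  obtain ⟨hb1, hbℓ⟩ := hb
  obtain ⟨hz_pos, hz_lower, -⟩ := norm_segment_bounds hb1 hx hbx ha ha'
  have hℓ : 0 ≤ ℓ := (l1_nonneg b).trans hbℓ
  have hl1 : l1 ((1 - a) • b + a • x) ≤ (1 - a) * ℓ + a * l1 x := by
    refine (l1_add_le _ _).trans ?_
    rw [l1_smul, l1_smul, abs_of_pos ha, abs_of_pos (sub_pos.2 ha')]
    gcongr
  set z := (1 - a) • b + a • x
  refine ⟨norm_smul_inv_norm (norm_pos_iff.1 hz_pos), ?_⟩
  rw [l1_smul, abs_inv, abs_norm, inv_mul_le_iff₀ hz_pos]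
  have gain : a * (1 - a) * (‖b - x‖ ^ 2 * ℓ) ≤ a * (ℓ - l1 x) := by
    rw [mul_assoc]
    gcongr
    have : 0 ≤ ‖b - x‖ ^ 2 * ℓ := by positivity
    nlinarith
  calc l1 z ≤ (1 - a * (1 - a) * ‖b - x‖ ^ 2) * ℓ := by linarith
    _ ≤ ‖z‖ * ℓ := by gcongr

/-- A maximizer `b` of a linear functional beats the feasible points on the normalized segment
from `b` to `x`, which bulges out of the chord by `‖b - x‖ ^ 2 / 2` to first order at `b`. -/
lemma sq_norm_sub_mul_le_of_isMaxOn {F : Vec p →ₗ[ℝ] ℝ} (hb : b ∈ feasible p ℓ) (hx : ‖x‖ = 1)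
    (hbx : ‖b - x‖ ^ 2 ≤ 1) (hslack : ‖b - x‖ ^ 2 * ℓ ≤ ℓ - l1 x)
    (hmax : ∀ v ∈ feasible p ℓ, F v ≤ F b) (hFb : 0 ≤ F b) :
    ‖b - x‖ ^ 2 / 2 * F b ≤ F (b - x) := by
  have segment : ∀ a ∈ Set.Ioo (0 : ℝ) 1, (1 - a) * (‖b - x‖ ^ 2 / 2 * F b) ≤ F (b - x) := by
    rintro a ⟨ha, ha'⟩
    obtain ⟨hz_pos, -, hz_upper⟩ := norm_segment_bounds hb.1 hx hbx ha ha'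
    have hle := hmax _ (normalized_segment_mem_feasible hb hx hbx hslack ha ha')
    rw [map_smul, smul_eq_mul, inv_mul_le_iff₀ hz_pos] at hle
    have hlin : F ((1 - a) • b + a • x) = F b - a * F (b - x) := by
      simp only [map_add, map_sub, map_smul, smul_eq_mul]
      ring
    refine le_of_mul_le_mul_left ?_ ha
    linarith [hle.trans (mul_le_mul_of_nonneg_right hz_upper hFb)]
  have limit : Tendsto (fun a : ℝ => (1 - a) * (‖b - x‖ ^ 2 / 2 * F b)) (𝓝[>] 0)
      (𝓝 ((1 - 0) * (‖b - x‖ ^ 2 / 2 * F b))) :=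
    ((by fun_prop : Continuous fun a : ℝ => (1 - a) * (‖b - x‖ ^ 2 / 2 * F b)).tendsto
      0).mono_left nhdsWithin_le_nhds
  simpa only [sub_zero, one_mul] using le_of_tendsto limit
    (eventually_of_mem (Ioo_mem_nhdsGT one_pos) segment)

end Interpolation

section ApproximateStep

variable {p : ℕ} {S L : LinearMap.BilinForm ℝ (Vec p)} {x b β : Vec p} {M γ η K e ℓ y κ : ℝ}
  {F : Vec p →ₗ[ℝ] ℝ}

lemma IsLeading.apply_sub_le_of_mem_feasible (h : IsLeading S L x M γ) (hK : 0 ≤ K) (he : 0 ≤ e)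
    (hb : b ∈ feasible p ℓ)
    (hF : |F (b - x) - stepForm S L η (b - x) β| ≤
      K * ((‖β - x‖ ^ 2 + e) * ‖b - x‖ + e * mixedNorm (l0 x) (b - x)))
    (hy : (ℓ - l1 x) / √(l0 x : ℝ) ≤ y) :
    F (b - x) ≤ -‖b - x‖ ^ 2 / 2 + stepForm S L η (b - x) (β - x) +
      4 * K * (‖β - x‖ ^ 2 + e) * ‖b - x‖ + K * (e * y) := by
  have hNorm : mixedNorm (l0 x) (b - x) ≤ 3 * ‖b - x‖ + y :=
    (mixedNorm_sub_le h.norm_eq).trans (add_le_add_right (hy.trans' (by gcongr; exact hb.2)) _)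
  have hsplit : stepForm S L η (b - x) β = -‖b - x‖ ^ 2 / 2 + stepForm S L η (b - x) (β - x) := by
    rw [map_sub _ β x, h.stepForm_apply_leading, inner_sub_self hb.1 h.norm_eq]
    ring
  have herr : K * ((‖β - x‖ ^ 2 + e) * ‖b - x‖ + e * mixedNorm (l0 x) (b - x)) ≤
      K * ((‖β - x‖ ^ 2 + e) * ‖b - x‖ + e * (3 * ‖b - x‖ + y)) := by gcongr
  have hH : 0 ≤ K * (‖β - x‖ ^ 2 * ‖b - x‖) := by positivity
  linarith [(abs_le.1 hF).2]

lemma sq_le_of_rough_bound {G H : ℝ} (hH : 0 ≤ H) (hH1 : H ≤ 1) (hG : 0 ≤ G) (hK : 0 ≤ K)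
    (he : 0 ≤ e) (hy : 0 ≤ y)
    (h : G ^ 2 / 2 ≤ G * H + 4 * K * (H ^ 2 + e) * G + K * (e * y)) :
    G ^ 2 ≤ 8 * (1 + 4 * K) ^ 2 * (H ^ 2 + e ^ 2 + e * y) := by
  have linear : G ^ 2 / 2 ≤ (1 + 4 * K) * (H + e) * G + K * (e * y) := by
    have : 4 * K * H ^ 2 * G ≤ 4 * K * H * G := by gcongr; nlinarith
    have : 0 ≤ e * G := by positivity
    linarith
  have young : G ^ 2 ≤ 4 * ((1 + 4 * K) * (H + e)) ^ 2 + 4 * K * (e * y) := by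
    linarith [sq_nonneg (G - 2 * ((1 + 4 * K) * (H + e)))]
  have square : (H + e) ^ 2 ≤ 2 * (H ^ 2 + e ^ 2) := by linarith [sq_nonneg (H - e)]
  have product : 4 * K * (e * y) ≤ 8 * (1 + 4 * K) ^ 2 * (e * y) :=
    mul_le_mul_of_nonneg_right (by nlinarith) (mul_nonneg he hy)
  calc G ^ 2 ≤ 4 * (1 + 4 * K) ^ 2 * (H + e) ^ 2 + 4 * K * (e * y) := by linarith
    _ ≤ 4 * (1 + 4 * K) ^ 2 * (2 * (H ^ 2 + e ^ 2)) + 8 * (1 + 4 * K) ^ 2 * (e * y) := by gcongr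
    _ = _ := by ring

lemma sq_le_of_fine_bound {G H : ℝ} (hG : 0 ≤ G) (hκ : 0 < κ) (hκ1 : κ ≤ 1)
    (hKH : 4 * K * H ≤ κ / 8) (hH : 0 ≤ H)
    (h : G ^ 2 * (1 - κ / 16) ≤
      (1 - κ) * (G * H) + 4 * K * (H ^ 2 + e) * G + K * (e * y)) :
    G ^ 2 ≤ (1 - κ / 2) * H ^ 2 + 2 * (64 * K ^ 2 / κ * e ^ 2 + K * (e * y)) := by
  have quadratic : 4 * K * H ^ 2 * G ≤ κ / 8 * (G * H) := by
    nlinarith [mul_le_mul_of_nonneg_right hKH (mul_nonneg hG hH)]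
  have young : 4 * K * e * G ≤ κ / 16 * G ^ 2 + 64 * K ^ 2 / κ * e ^ 2 := by
    have : κ / 16 * G ^ 2 + 64 * K ^ 2 / κ * e ^ 2 - 4 * K * e * G =
        (κ * G - 32 * K * e) ^ 2 / (16 * κ) := by
      field_simp
      ring
    linarith [show 0 ≤ (κ * G - 32 * K * e) ^ 2 / (16 * κ) by positivity]
  have cross : (1 - 7 * κ / 8) * (G * H) ≤ (1 - 7 * κ / 8) * ((G ^ 2 + H ^ 2) / 2) :=
    mul_le_mul_of_nonneg_left (by linarith [sq_nonneg (G - H)]) (by linarith)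
  have : 0 ≤ κ * G ^ 2 := by positivity
  have : 0 ≤ κ * H ^ 2 := by positivity
  linarith

namespace IsLeading

variable (h : IsLeading S L x M γ) (hη : 0 ≤ η) (hηM : η * M ≤ 1) (hK : 0 ≤ K) (he : 0 ≤ e)
  (hβ : ‖β‖ = 1) (hℓ : l1 x ≤ ℓ)
  (hF : ∀ v, |F v - stepForm S L η v β| ≤
    K * ((‖β - x‖ ^ 2 + e) * ‖v‖ + e * mixedNorm (l0 x) v))
  (hmax : ∀ v ∈ feasible p ℓ, F v ≤ F b)
include h hη hηM hK he hℓ hF hmax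

include hβ in
lemma one_sub_le_apply (hsmall : (1 + 3 * K) * (‖β - x‖ ^ 2 + e) ≤ κ / 8) :
    1 - κ / 8 ≤ F b := by
  have hxβ : stepForm S L η x β = 1 - ‖β - x‖ ^ 2 / 2 := by
    rw [(h.isPosSemidef_stepForm hη hηM).eq, h.stepForm_apply_leading]
    linarith [inner_sub_self hβ h.norm_eq, inner_sub_left (𝕜 := ℝ) β x x,
      real_inner_self_eq_norm_sq x, congrArg (· ^ 2) h.norm_eq]
  have hFx := (abs_le.1 (hF x)).1
  have hNx : e * mixedNorm (l0 x) x ≤ e * 2 := by gcongr; exact mixedNorm_l0_self_le h.norm_eq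
  rw [hxβ, h.norm_eq] at hFx
  have : K * (e * mixedNorm (l0 x) x) ≤ K * (e * 2) := by gcongr
  have : 0 ≤ K * ‖β - x‖ ^ 2 := by positivity
  linarith [hmax x ⟨h.norm_eq, hℓ⟩, sq_nonneg ‖β - x‖]

variable (hb : b ∈ feasible p ℓ) (hy : (ℓ - l1 x) / √(l0 x : ℝ) ≤ y)
include hb hy

lemma sq_norm_sub_le_of_approxStep (hβx : ‖β - x‖ ^ 2 ≤ 1) :
    ‖b - x‖ ^ 2 ≤ 8 * (1 + 4 * K) ^ 2 * (‖β - x‖ ^ 2 + e ^ 2 + e * y) := by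
  have hy0 : 0 ≤ y := (div_nonneg (sub_nonneg.2 hℓ) (Real.sqrt_nonneg _)).trans hy
  have hxb : F x ≤ F b := hmax x ⟨h.norm_eq, hℓ⟩
  refine sq_le_of_rough_bound (norm_nonneg _)
    ((pow_le_one_iff_of_nonneg (norm_nonneg _) two_ne_zero).1 hβx) (norm_nonneg _) hK he hy0 ?_
  linarith [h.apply_sub_le_of_mem_feasible hK he hb (hF _) hy, map_sub F b x,
    h.stepForm_apply_le hη hηM (b - x) (β - x)]

include hβ in
lemma sq_norm_sub_le_contraction (hκ : κ = η * γ / (2 * M)) (hκ0 : 0 < κ) (hκ1 : κ ≤ 1)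
    (hℓ0 : 0 < ℓ) (hβx : ‖β - x‖ ^ 2 ≤ 1)
    (hsmall : (1 + 3 * K) * (‖β - x‖ ^ 2 + e) ≤ κ / 8) (hKβ : 4 * K * ‖β - x‖ ≤ κ / 8)
    (hslack : ‖b - x‖ ^ 2 * ℓ ≤ ℓ - l1 x) :
    ‖b - x‖ ^ 2 ≤ (1 - κ / 2) * ‖β - x‖ ^ 2 + 2 * (64 * K ^ 2 / κ * e ^ 2 + K * (e * y)) := by
  have hbx : ‖b - x‖ ^ 2 ≤ 1 := le_of_mul_le_mul_right (by linarith [l1_nonneg x]) hℓ0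
  have hFb := h.one_sub_le_apply hη hηM hK he hβ hℓ hF hmax hsmall
  have hupper := h.apply_sub_le_of_mem_feasible hK he hb (hF _) hy
  have hlower := sq_norm_sub_mul_le_of_isMaxOn hb h.norm_eq hbx hslack hmax (by linarith)
  have hcontract := h.stepForm_sub_apply_sub_le hη hηM (hκ ▸ hκ1) hb.1 hβ (by linarith)
    (by linarith)
  rw [← hκ] at hcontract
  refine sq_le_of_fine_bound (norm_nonneg _) hκ0 hκ1 hKβ (norm_nonneg _) ?_
  have : ‖b - x‖ ^ 2 / 2 * (1 - κ / 8) ≤ ‖b - x‖ ^ 2 / 2 * F b := by gcongr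
  linarith

end IsLeading

end ApproximateStep

lemma eventually_mul_le (a : ℝ) {b : ℝ} (hb : 0 < b) : ∀ᶠ c in 𝓝[>] (0 : ℝ), a * c ≤ b := by
  have h : Tendsto (fun c : ℝ => a * c) (𝓝[>] 0) (𝓝 (a * 0)) :=
    ((continuous_const_mul a).tendsto 0).mono_left nhdsWithin_le_nhds
  exact h.eventually_le_const (by simpa using hb)

lemma eventually_le_mul {a : ℝ} (ha : 0 < a) (b : ℝ) : ∀ᶠ k in atTop, b ≤ a * k :=
  (tendsto_id.const_mul_atTop ha).eventually_ge_atTop b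

section Recursion

variable {A κ R Q c c₀ μ K₁ e : ℝ}

lemma recursion_premises {g y z : ℝ} (hR : 0 ≤ R) (hc : 0 ≤ c) (hcA : A ^ 2 * c ≤ c₀)
    (hcR : 4 * R * A * c ≤ 1) (he : 0 ≤ e) (heR : 4 * R * e ≤ 1) (hez : e ≤ z) (hy : 0 ≤ y)
    (hyA : y ≤ A) (hyz : y ≤ 2 * z) (hg : g ≤ c * y ^ 2) :
    g ≤ c₀ ∧ R * (g + e ^ 2 + e * z) ≤ z := by
  have hz : 0 ≤ z := he.trans hez
  refine ⟨hg.trans (hcA.trans' ?_), ?_⟩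
  · rw [mul_comm (A ^ 2)]
    gcongr
  calc R * (g + e ^ 2 + e * z) ≤ R * (c * (A * (2 * z)) + e * z + e * z) := by
        have : c * y ^ 2 ≤ c * (A * (2 * z)) := by rw [pow_two]; gcongr; linarith
        have : e ^ 2 ≤ e * z := by rw [pow_two]; gcongr
        gcongr
        linarith
    _ = 4 * R * A * c * (z / 2) + 4 * R * e * (z / 2) := by ring
    _ ≤ 1 * (z / 2) + 1 * (z / 2) := by gcongr
    _ = z := by ring

lemma recursion_conclusion {g y z : ℝ} (hκ : 0 < κ) (hκ1 : κ ≤ 1) (hQ : 0 ≤ Q) (hc : 0 ≤ c)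
    (hKc : 2 * Q ≤ c * κ / 8 * K₁) (he : 0 ≤ e) (hez : e ≤ z) (hK : K₁ * e ≤ z) (hy : 0 ≤ y)
    (hyz : y ≤ (1 + κ / 8) * z) (hg : g ≤ c * y ^ 2) :
    (1 - κ / 2) * g + Q * (e ^ 2 + e * z) ≤ c * z ^ 2 := by
  have hz : 0 ≤ z := he.trans hez
  have main : (1 - κ / 2) * g ≤ (1 - κ / 2) * (1 + κ / 8) ^ 2 * (c * z ^ 2) := by
    calc (1 - κ / 2) * g ≤ (1 - κ / 2) * (c * ((1 + κ / 8) * z) ^ 2) :=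
          mul_le_mul_of_nonneg_left (hg.trans (by gcongr)) (by linarith)
      _ = _ := by ring
  have error : Q * (e ^ 2 + e * z) ≤ κ / 8 * (c * z ^ 2) := by
    calc Q * (e ^ 2 + e * z) ≤ Q * (e * z + e * z) := by rw [pow_two]; gcongr
      _ = 2 * Q * (e * z) := by ring
      _ ≤ c * κ / 8 * K₁ * (e * z) := by gcongr
      _ = c * κ / 8 * (K₁ * e * z) := by ring
      _ ≤ c * κ / 8 * (z * z) := by gcongr
      _ = _ := by ring
  have factor : (1 - κ / 2) * (1 + κ / 8) ^ 2 ≤ 1 - κ / 8 := by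
    linarith [sq_nonneg κ, pow_pos hκ 3]
  linarith [mul_le_mul_of_nonneg_right factor (show 0 ≤ c * z ^ 2 by positivity)]

/-- A quantity `g` that contracts geometrically up to errors `e * y` stays below a multiple of
`y ^ 2` for as long as `y`, which decreases slowly, dominates `e`. -/
lemma exists_recursion_constants (hκ : 0 < κ) (hκ1 : κ ≤ 1) (hR : 0 ≤ R) (hQ : 0 ≤ Q)
    (hc₀ : 0 < c₀) :
    ∃ c : ℝ, 0 < c ∧ ∀ μ K₀ : ℝ, ∃ K₁ e₀ : ℝ, K₀ ≤ K₁ ∧ 0 < K₁ ∧ 0 < e₀ ∧ e₀ ≤ c₀ ∧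
      ∀ {e : ℝ} {g y : ℕ → ℝ}, 0 < e → e ≤ e₀ → (∀ t, y t ≤ A) →
        (∀ t, y t ≤ y (t + 1) + μ * e) → (∀ t, 0 < y (t + 1) → g t ≤ c₀ →
          R * (g t + e ^ 2 + e * y (t + 1)) ≤ y (t + 1) →
          g (t + 1) ≤ (1 - κ / 2) * g t + Q * (e ^ 2 + e * y (t + 1))) →
        g 0 ≤ c * y 0 ^ 2 → ∀ t, (∀ i ≤ t, K₁ * e ≤ y i) → g t ≤ c * y t ^ 2 := by
  obtain ⟨c, ⟨hcA, hcR⟩, hc⟩ := (((eventually_mul_le (A ^ 2) hc₀).and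
    (eventually_mul_le (4 * R * A) one_pos)).and self_mem_nhdsWithin).exists
  refine ⟨c, hc, fun μ K₀ => ?_⟩
  have hc_pos : 0 < c := hc
  obtain ⟨e₀, ⟨he₀R, he₀c⟩, he₀⟩ := (((eventually_mul_le (4 * R) one_pos).and
    (eventually_mul_le 1 hc₀)).and self_mem_nhdsWithin).exists
  obtain ⟨K₁, ⟨⟨hK₀, hK1⟩, hKμ⟩, hKc⟩ := ((((eventually_ge_atTop K₀).and
    (eventually_ge_atTop 1)).and (eventually_le_mul (show 0 < κ / 8 by positivity) μ)).and
    (eventually_le_mul (show 0 < c * κ / 8 by positivity) (2 * Q))).exists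
  refine ⟨K₁, e₀, hK₀, by linarith, he₀, by linarith, ?_⟩
  intro e g y he hee₀ hyA hdrop hstep hstart t
  induction t with
  | zero => exact fun _ => hstart
  | succ t ih =>
    intro hbig
    have hg := ih fun i hi => hbig i (by omega)
    have hy : 0 ≤ y t := (hbig t (by omega)).trans' (by positivity)
    have hKz := hbig (t + 1) le_rfl
    have hez : e ≤ y (t + 1) := hKz.trans' (le_mul_of_one_le_left he.le hK1)
    have hμ : μ * e ≤ κ / 8 * y (t + 1) :=
      calc μ * e ≤ κ / 8 * (K₁ * e) := by rw [← mul_assoc]; gcongr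
        _ ≤ κ / 8 * y (t + 1) := by gcongr
    have hyz : y t ≤ (1 + κ / 8) * y (t + 1) := by linarith [hdrop t]
    obtain ⟨hg_small, hslack⟩ := recursion_premises hR hc_pos.le hcA hcR he.le
      (he₀R.trans' (by gcongr)) hez hy (hyA t) (hyz.trans (by gcongr <;> linarith)) hg
    exact (hstep t (he.trans_le hez) hg_small hslack).trans
      (recursion_conclusion hκ hκ1 hQ hc_pos.le hKc he.le hez hKz hy hyz hg)

end Recursion

section Ascent

variable {p : ℕ}

/-- The linear functional `v ↦ ⟪v, θ⟫` of the gradient step `θ = β + (η / f) (S - f L) β` for the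
Rayleigh quotient `f = S β β / L β β`. -/
def ascent {E : Type*} [NormedAddCommGroup E] [InnerProductSpace ℝ E]
    (S L : LinearMap.BilinForm ℝ E) (η : ℝ) (β : E) : E →ₗ[ℝ] ℝ :=
  (innerₗ E + (η / (S β β / L β β)) • (S - (S β β / L β β) • L)).flip β

lemma ascent_apply {E : Type*} [NormedAddCommGroup E] [InnerProductSpace ℝ E]
    (S L : LinearMap.BilinForm ℝ E) (η : ℝ) (β v : E) : ascent S L η β v =
      inner ℝ v β + η / (S β β / L β β) * (S v β - S β β / L β β * L v β) :=
  rfl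

lemma ascent_smul {E : Type*} [NormedAddCommGroup E] [InnerProductSpace ℝ E]
    (S L : LinearMap.BilinForm ℝ E) (η : ℝ) {a : ℝ} (ha : a ≠ 0) :
    ascent (a • S) L η = ascent S L η := by
  ext β v
  simp only [ascent_apply, LinearMap.smul_apply, smul_eq_mul]
  field_simp

/-- The vectors `b t` are iterates of projected gradient ascent with `ℓ₁` bounds `ℓ t`: each one
maximizes the functional `ascent` of its predecessor. -/
def IsAscentRun (S L : LinearMap.BilinForm ℝ (Vec p)) (η : ℝ) (ℓ : ℕ → ℝ) (b : ℕ → Vec p) :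
    Prop :=
  ∀ t, b t ∈ feasible p (ℓ t) ∧
    ∀ v ∈ feasible p (ℓ (t + 1)), ascent S L η (b t) v ≤ ascent S L η (b t) (b (t + 1))

/-- The constant in the error of the empirical gradient step. -/
def ascentConst (M η A : ℝ) : ℝ := η * (2 * M ^ 2 * (M + 2 * (1 + A) ^ 2) + 3 * (1 + A))

variable {S L S' L' : LinearMap.BilinForm ℝ (Vec p)} {x b β : Vec p} {M γ η e A ℓ : ℝ}

namespace IsLeading

variable (h : IsLeading S L x M γ)
  (hS : IsClose (mixedNorm (l0 x)) e S S') (hL : IsClose (mixedNorm (l0 x)) e L L')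
  (he : 0 ≤ e) (hη : 0 ≤ η) (hA : 0 ≤ A)
include h hS hL he hη hA

lemma abs_ascent_sub_le (hβ : ‖β‖ = 1) (hβA : l1 β ≤ A * √(l0 x : ℝ))
    (hsmall : M * ‖β - x‖ ^ 2 + 2 * (e * (1 + A) ^ 2) ≤ 1 / (2 * M)) (v : Vec p) :
    |ascent S' L' η β v - stepForm S L η v β| ≤
      ascentConst M η A * ((‖β - x‖ ^ 2 + e) * ‖v‖ + e * mixedNorm (l0 x) v) := by
  have hM := h.const_pos
  have hN := mixedNorm_le (sqrt_l0_pos h.norm_eq) hβ hβA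
  have hpos := h.inv_le_apply_self_of_isClose hS hL he hβ hN hsmall
  have hgrad := h.abs_gradient_sub_le hS hL he hβ hN hsmall v
  have hdiff : ascent S' L' η β v - stepForm S L η v β =
      η * ((L' β β / S' β β * S' v β - L' v β) - (S v β - L v β)) := by
    have hS_ne : S' β β ≠ 0 := (lt_of_lt_of_le (by positivity) hpos.1).ne'
    have hL_ne : L' β β ≠ 0 := (lt_of_lt_of_le (by positivity) hpos.2).ne'
    rw [ascent_apply, stepForm_apply]
    field_simp
    ring
  rw [hdiff, abs_mul, abs_of_nonneg hη, ascentConst, mul_assoc]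
  refine mul_le_mul_of_nonneg_left (hgrad.trans ?_) hη
  have : 0 ≤ M ^ 2 * M * e * ‖v‖ := by positivity
  have : 0 ≤ M ^ 2 * (1 + A) ^ 2 * ‖β - x‖ ^ 2 * ‖v‖ := by positivity
  have : 0 ≤ (1 + A) * (‖β - x‖ ^ 2 + e) * ‖v‖ := by positivity
  have : 0 ≤ M ^ 2 * (M + 2 * (1 + A) ^ 2) * (e * mixedNorm (l0 x) v) := by positivity
  linarith

/-- `c₀` is a threshold for the squared distance to `x` and the statistical error below which the
ascent step is contractive. -/
lemma sq_norm_sub_le_of_ascent {K κ c₀ y : ℝ} (hηM : η * M ≤ 1) (hK : K = ascentConst M η A)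
    (hκ : κ = η * γ / (2 * M)) (hκ0 : 0 < κ) (hκ1 : κ ≤ 1)
    (hc₀ : c₀ ≤ 1) (hc₀M : (M + 2 * (1 + A) ^ 2) * c₀ ≤ 1 / (2 * M))
    (hc₀K : (1 + 3 * K) * 2 * c₀ ≤ κ / 8) (hc₀K' : (4 * K) ^ 2 * c₀ ≤ (κ / 8) ^ 2)
    (hβ : ‖β‖ = 1) (hβA : l1 β ≤ A * √(l0 x : ℝ)) (hb : b ∈ feasible p ℓ)
    (hmax : ∀ v ∈ feasible p ℓ, ascent S' L' η β v ≤ ascent S' L' η β b)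
    (hℓA : ℓ ≤ A * √(l0 x : ℝ)) (hy : y = (ℓ - l1 x) / √(l0 x : ℝ)) (hy0 : 0 < y)
    (hβc : ‖β - x‖ ^ 2 ≤ c₀) (hec : e ≤ c₀)
    (hslack : A * (8 * (1 + 4 * K) ^ 2) * (‖β - x‖ ^ 2 + e ^ 2 + e * y) ≤ y) :
    ‖b - x‖ ^ 2 ≤ (1 - κ / 2) * ‖β - x‖ ^ 2 + 2 * (64 * K ^ 2 / κ * e ^ 2 + K * (e * y)) := by
  have hs := sqrt_l0_pos h.norm_eq
  have hM := h.const_pos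
  have hK0 : 0 ≤ K := by rw [hK, ascentConst]; positivity
  have hℓ : l1 x < ℓ := sub_pos.1 ((div_pos_iff_of_pos_right hs).1 (hy ▸ hy0))
  have hsmall : M * ‖β - x‖ ^ 2 + 2 * (e * (1 + A) ^ 2) ≤ 1 / (2 * M) := by
    refine hc₀M.trans' ?_
    rw [add_mul, mul_assoc 2, mul_comm e]
    gcongr
  have hF := h.abs_ascent_sub_le hS hL he hη hA hβ hβA hsmall
  rw [← hK] at hF
  have hrough := h.sq_norm_sub_le_of_approxStep hη hηM hK0 he hℓ.le hF hmax hb hy.ge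
    (hβc.trans hc₀)
  have hℓ_slack : ‖b - x‖ ^ 2 * ℓ ≤ ℓ - l1 x :=
    calc ‖b - x‖ ^ 2 * ℓ ≤ ‖b - x‖ ^ 2 * (A * √(l0 x : ℝ)) := by gcongr
      _ = A * ‖b - x‖ ^ 2 * √(l0 x : ℝ) := by ring
      _ ≤ y * √(l0 x : ℝ) := by
        gcongr
        exact hslack.trans' (by rw [mul_assoc]; gcongr)
      _ = ℓ - l1 x := by rw [hy, div_mul_cancel₀ _ hs.ne']
  refine h.sq_norm_sub_le_contraction hη hηM hK0 he hβ hℓ.le hF hmax hb hy.ge hκ hκ0 hκ1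
    ((l1_nonneg x).trans_lt hℓ) (hβc.trans hc₀) ?_ ?_ hℓ_slack
  · refine hc₀K.trans' ?_
    rw [mul_assoc]
    gcongr
    linarith
  · refine le_of_sq_le_sq (hc₀K'.trans' ?_) (by positivity)
    rw [mul_pow]
    gcongr

end IsLeading

lemma exists_run_constants {M γ η A : ℝ} (hM : 0 < M) (hγ : 0 < γ) (hη : 0 < η)
    (hηM : η * M ≤ 1) (hκ1 : η * γ / (2 * M) ≤ 1) (hA : 1 ≤ A) :
    ∃ c : ℝ, 0 < c ∧ ∀ μ K₀ : ℝ, ∃ K₁ e₀ : ℝ, K₀ ≤ K₁ ∧ 0 < K₁ ∧ 0 < e₀ ∧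
      ∀ {p : ℕ} {S L S' L' : LinearMap.BilinForm ℝ (Vec p)} {x : Vec p} {e : ℝ}
        {b : ℕ → Vec p} {ℓ y : ℕ → ℝ}, IsLeading S L x M γ →
        IsClose (mixedNorm (l0 x)) e S S' → IsClose (mixedNorm (l0 x)) e L L' → 0 < e → e ≤ e₀ →
        IsAscentRun S' L' η ℓ b → (∀ t, ℓ t ≤ A * √(l0 x : ℝ)) →
        (∀ t, y t = (ℓ t - l1 x) / √(l0 x : ℝ)) → (∀ t, y t ≤ y (t + 1) + μ * e) →
        ‖b 0 - x‖ ^ 2 ≤ c * y 0 ^ 2 →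
        ∀ t, (∀ i ≤ t, K₁ * e ≤ y i) → ‖b t - x‖ ^ 2 ≤ c * y t ^ 2 := by
  obtain ⟨K, hK⟩ : ∃ K, K = ascentConst M η A := ⟨_, rfl⟩
  obtain ⟨κ, hκ⟩ : ∃ κ, κ = η * γ / (2 * M) := ⟨_, rfl⟩
  have hK0 : 0 ≤ K := by rw [hK, ascentConst]; positivity
  have hκ0 : 0 < κ := by rw [hκ]; positivity
  rw [← hκ] at hκ1
  obtain ⟨c₀, ⟨⟨⟨h1, hc₀M⟩, hc₀K⟩, hc₀K'⟩, hc₀⟩ := (((((eventually_mul_le 1 one_pos).and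
    (eventually_mul_le (M + 2 * (1 + A) ^ 2) (show 0 < 1 / (2 * M) by positivity))).and
    (eventually_mul_le ((1 + 3 * K) * 2) (show 0 < κ / 8 by positivity))).and
    (eventually_mul_le ((4 * K) ^ 2) (show 0 < (κ / 8) ^ 2 by positivity))).and
    self_mem_nhdsWithin).exists
  rw [one_mul] at h1
  obtain ⟨c, hc, hrec⟩ := exists_recursion_constants (A := A) (κ := κ)
    (R := A * (8 * (1 + 4 * K) ^ 2)) (Q := 2 * (64 * K ^ 2 / κ + K)) hκ0 hκ1 (by positivity)
    (by positivity) hc₀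
  refine ⟨c, hc, fun μ K₀ => ?_⟩
  obtain ⟨K₁, e₀, hK₀, hK₁, he₀, he₀c, hrec⟩ := hrec μ K₀
  refine ⟨K₁, e₀, hK₀, hK₁, he₀, ?_⟩
  intro p S L S' L' x e b ℓ y h hS hL he hee₀ hrun hℓA hy hdrop hstart
  refine hrec (g := fun t => ‖b t - x‖ ^ 2) he hee₀ (fun t => ?_) hdrop ?_ hstart
  · rw [hy, div_le_iff₀ (sqrt_l0_pos h.norm_eq)]
    linarith [hℓA t, l1_nonneg x]
  · intro t hyt hc hslack
    refine (h.sq_norm_sub_le_of_ascent hS hL he.le hη.le (by linarith) hηM hK hκ hκ0 hκ1 h1 hc₀M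
      hc₀K hc₀K' (hrun t).1.1 ((hrun t).1.2.trans (hℓA t)) (hrun (t + 1)).1 (hrun t).2
      (hℓA (t + 1)) (hy (t + 1)) hyt hc (hee₀.trans he₀c) hslack).trans ?_
    have : 0 ≤ 64 * K ^ 2 / κ * (e * y (t + 1)) := by positivity
    have : 0 ≤ K * e ^ 2 := by positivity
    linarith

end Ascent

section Penalized

section Recentering

variable {E : Type*} [NormedAddCommGroup E] [InnerProductSpace ℝ E] {N : Seminorm ℝ E}
  {S L S' L' B B' : LinearMap.BilinForm ℝ E} {x b : E} {M γ e N₀ : ℝ}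

lemma IsClose.abs_self_sub_le (h : IsClose N e B B') (he : 0 ≤ e) (hBx : ∀ v, B v x = 0)
    (hxB : ∀ v, B x v = 0) (hx : B' x x = 0) (hxN : N x ≤ N₀) (hbN : N b ≤ N₀) :
    |B' b b - B (b - x) (b - x)| ≤ 4 * N₀ * (e * N (b - x)) := by
  have hexpand : B' b b - B (b - x) (b - x) = (B' (b - x) (b - x) - B (b - x) (b - x)) +
      (B' (b - x) x - B (b - x) x) + (B' x (b - x) - B x (b - x)) := by
    simp only [hBx, hxB, map_sub, LinearMap.sub_apply, hx]
    ring
  have hsize : N (b - x) + 2 * N x ≤ 4 * N₀ := by linarith [map_sub_le_add N b x]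
  calc |B' b b - B (b - x) (b - x)|
      ≤ e * (N (b - x) * N (b - x)) + e * (N (b - x) * N x) + e * (N x * N (b - x)) := by
        rw [hexpand]
        exact (abs_add_three _ _ _).trans
          (add_le_add_three (h (b - x) (b - x)) (h (b - x) x) (h x (b - x)))
    _ = (N (b - x) + 2 * N x) * (e * N (b - x)) := by ring
    _ ≤ _ := by gcongr

namespace IsLeading

variable (h : IsLeading S L x M γ) (hS : IsClose N e S S') (hL : IsClose N e L L')
  (he : 0 ≤ e) (hsmall : 4 * N₀ ^ 2 * e ≤ 1 / (2 * M))
include h hL he hsmall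

lemma apply_self_mem_Icc_of_isClose (hb : ‖b‖ = 1) (hbN : N b ≤ N₀) :
    L' b b ∈ Set.Icc (1 / (2 * M)) (2 * M) := by
  have hM := h.const_pos
  have hLb := abs_le.1 (hL.abs_self_le he hbN)
  have hlower := h.lower b
  have hupper := h.upper b
  rw [hb, one_pow] at hlower hupper
  have hlower' : 2 * (1 / (2 * M)) ≤ L b b := by
    rw [← mul_div_assoc, div_le_iff₀ (by positivity)]
    linarith
  have : 0 ≤ N₀ ^ 2 * e := by positivity
  constructor <;> linarith

include hS

lemma abs_rayleigh_sub_one_le (hxN : N x ≤ N₀) :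
    |S' x x / L' x x - 1| ≤ 4 * M * N₀ ^ 2 * e := by
  have hM := h.const_pos
  have hlower := (h.apply_self_mem_Icc_of_isClose hL he hsmall h.norm_eq hxN).1
  have hpos : 0 < L' x x := lt_of_lt_of_le (by positivity) hlower
  rw [div_sub_one hpos.ne', abs_div, abs_of_pos hpos, div_le_iff₀ hpos]
  calc |S' x x - L' x x| = |(S' x x - S x x) - (L' x x - L x x)| := by
        rw [h.eigen]
        ring_nf
    _ ≤ e * N₀ ^ 2 + e * N₀ ^ 2 :=
        (abs_sub _ _).trans (add_le_add (hS.abs_self_le he hxN) (hL.abs_self_le he hxN))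
    _ = 4 * M * N₀ ^ 2 * e * (1 / (2 * M)) := by
        field_simp
        ring
    _ ≤ _ := by gcongr

lemma isClose_sub_rayleigh_smul (hN : ∀ u, ‖u‖ ≤ N u) (hxN : N x ≤ N₀) :
    IsClose N ((3 + 4 * M ^ 2 * N₀ ^ 2) * e) (S - L) (S' - (S' x x / L' x x) • L') := by
  intro u v
  have hM := h.const_pos
  have hf := h.abs_rayleigh_sub_one_le hS hL he hsmall hxN
  set f := S' x x / L' x x
  have hf_le : |f| ≤ 2 := by
    have hle : 4 * M * N₀ ^ 2 * e ≤ 1 / 2 := by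
      calc 4 * M * N₀ ^ 2 * e = M * (4 * N₀ ^ 2 * e) := by ring
        _ ≤ M * (1 / (2 * M)) := by gcongr
        _ = 1 / 2 := by field_simp
    have := abs_le.1 hf
    rw [abs_le]
    constructor <;> linarith
  have hLuv : |L u v| ≤ M * (N u * N v) := (h.abs_right_le u v).trans (by
    gcongr <;> exact hN _)
  simp only [LinearMap.sub_apply, LinearMap.smul_apply, smul_eq_mul]
  calc |(S' u v - f * L' u v) - (S u v - L u v)|
      = |(S' u v - S u v) - f * (L' u v - L u v) - (f - 1) * L u v| := by ring_nf
    _ ≤ |S' u v - S u v| + |f * (L' u v - L u v)| + |(f - 1) * L u v| :=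
        (abs_sub _ _).trans (by gcongr; exact abs_sub _ _)
    _ ≤ e * (N u * N v) + 2 * (e * (N u * N v)) + 4 * M * N₀ ^ 2 * e * (M * (N u * N v)) := by
        rw [abs_mul, abs_mul]
        gcongr
        · exact hS u v
        · exact hL u v
    _ = _ := by ring

lemma exists_rayleigh_sub_eq_div (hN : ∀ u, ‖u‖ ≤ N u) (hxN : N x ≤ N₀) (hb : ‖b‖ = 1)
    (hbN : N b ≤ N₀) :
    ∃ Q D : ℝ, S' b b / L' b b - S' x x / L' x x = Q / D ∧ D ∈ Set.Icc (1 / (2 * M)) (2 * M) ∧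
      |Q - (S (b - x) (b - x) - L (b - x) (b - x))| ≤
        4 * N₀ * ((3 + 4 * M ^ 2 * N₀ ^ 2) * e * N (b - x)) := by
  have hM := h.const_pos
  have hD := h.apply_self_mem_Icc_of_isClose hL he hsmall hb hbN
  have hLb : L' b b ≠ 0 := (lt_of_lt_of_le (by positivity) hD.1).ne'
  have hLx : L' x x ≠ 0 := (lt_of_lt_of_le (by positivity)
    (h.apply_self_mem_Icc_of_isClose hL he hsmall h.norm_eq hxN).1).ne'
  refine ⟨S' b b - S' x x / L' x x * L' b b, L' b b, by rw [sub_div, mul_div_cancel_right₀ _ hLb],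
    hD, ?_⟩
  refine (h.isClose_sub_rayleigh_smul hS hL he hsmall hN hxN).abs_self_sub_le (by positivity)
    (fun v => ?_) (fun v => ?_) ?_ hxN hbN
  · simp [h.eigen]
  · simp [← h.posSemidef.eq v x, ← h.symm.eq v x, h.eigen]
  · simp [hLx]

end IsLeading

end Recentering

lemma div_le_of_le_sub {Q D P R M : ℝ} (hM : 0 < M) (hD : D ∈ Set.Icc (1 / (2 * M)) (2 * M))
    (hP : 0 ≤ P) (hR : 0 ≤ R) (h : Q ≤ R - P) : Q / D ≤ 2 * M * R - P / (2 * M) := by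
  have hD_pos : 0 < D := lt_of_lt_of_le (by positivity) hD.1
  rw [div_le_iff₀ hD_pos]
  have hone : 1 ≤ 2 * M * D := (div_le_iff₀' (by positivity)).1 hD.1
  have hR' : R ≤ 2 * M * D * R := le_mul_of_one_le_left hR hone
  have hP' : P / (2 * M) * D ≤ P := by
    calc P / (2 * M) * D ≤ P / (2 * M) * (2 * M) := by
          gcongr
          exact hD.2
      _ = P := by field_simp
  linarith

section Empirical

variable {p : ℕ} {S L S' L' : LinearMap.BilinForm ℝ (Vec p)} {x b w : Vec p} {M γ e A : ℝ}

lemma norm_le_mixedNorm (s : ℕ) (u : Vec p) : ‖u‖ ≤ mixedNorm s u :=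
  le_add_of_nonneg_right (div_nonneg (l1_nonneg _) (Real.sqrt_nonneg _))

/-- The constant in the error of the recentered empirical Rayleigh quotient. -/
def recenteringConst (M A : ℝ) : ℝ :=
  2 * M * (4 * (1 + A) * (3 + 4 * M ^ 2 * (1 + A) ^ 2))

namespace IsLeading

variable (h : IsLeading S L x M γ) (hS : IsClose (mixedNorm (l0 x)) e S S')
  (hL : IsClose (mixedNorm (l0 x)) e L L') (he : 0 ≤ e) (hA : 1 ≤ A)
  (hsmall : 4 * (1 + A) ^ 2 * e ≤ 1 / (2 * M))
include h hS hL he hA hsmall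

lemma rayleigh_sub_le (hb : b ∈ feasible p (A * √(l0 x : ℝ))) (hbx : ‖b - x‖ ^ 2 ≤ 2) :
    S' b b / L' b b - S' x x / L' x x ≤
      recenteringConst M A * (e * mixedNorm (l0 x) (b - x)) - γ / (4 * M ^ 2) * ‖b - x‖ ^ 2 := by
  have hM := h.const_pos
  have hγ := h.gap_pos
  obtain ⟨Q, D, hQ, hD, hQD⟩ := h.exists_rayleigh_sub_eq_div hS hL he hsmall
    (norm_le_mixedNorm _) ((mixedNorm_l0_self_le h.norm_eq).trans (by linarith)) hb.1
    (mixedNorm_le (sqrt_l0_pos h.norm_eq) hb.1 hb.2)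
  rw [hQ]
  refine (div_le_of_le_sub hM hD (P := γ / (2 * M) * ‖b - x‖ ^ 2) (by positivity)
    ((abs_nonneg _).trans hQD) ?_).trans_eq ?_
  · linarith [h.curvature hb.1 hbx, (abs_le.1 hQD).2]
  · rw [recenteringConst]
    ring

lemma sub_rayleigh_le (hw : w ∈ feasible p (A * √(l0 x : ℝ))) :
    S' x x / L' x x - S' w w / L' w w ≤
      recenteringConst M A * (e * mixedNorm (l0 x) (w - x)) + 2 * M ^ 2 * ‖w - x‖ ^ 2 := by
  have hM := h.const_pos
  obtain ⟨Q, D, hQ, hD, hQD⟩ := h.exists_rayleigh_sub_eq_div hS hL he hsmall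
    (norm_le_mixedNorm _) ((mixedNorm_l0_self_le h.norm_eq).trans (by linarith)) hw.1
    (mixedNorm_le (sqrt_l0_pos h.norm_eq) hw.1 hw.2)
  rw [← neg_sub, hQ, ← neg_div]
  refine (div_le_of_le_sub hM hD (P := 0) le_rfl
    (add_nonneg ((abs_nonneg _).trans hQD) (by positivity : 0 ≤ M * ‖w - x‖ ^ 2)) ?_).trans_eq ?_
  · linarith [h.posSemidef.nonneg (w - x), h.upper (w - x), (abs_le.1 hQD).1]
  · rw [recenteringConst]
    ring

end IsLeading

end Empirical

section Penalty

/-- The penalty `u + c₂ u ^ 2 / A` as a function of the rescaled `ℓ₁` norm `u = ‖b‖₁ / √s`. -/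
def penalty (c₂ A u : ℝ) : ℝ := u + c₂ * u ^ 2 / A

variable {c₂ A u v : ℝ}

lemma penalty_sub_mem_Icc (hc₂ : 0 < c₂) (hA : 0 < A) (hu : 0 ≤ u) (huv : u ≤ v) (hv : v ≤ A) :
    penalty c₂ A v - penalty c₂ A u ∈ Set.Icc (v - u) ((1 + 2 * c₂) * (v - u)) := by
  have hfactor : penalty c₂ A v - penalty c₂ A u = (1 + c₂ * ((v + u) / A)) * (v - u) := by
    rw [penalty, penalty]
    ring
  have hnonneg : 0 ≤ (v + u) / A := div_nonneg (by linarith) hA.le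
  have hle : (v + u) / A ≤ 2 := by
    rw [div_le_iff₀ hA]
    linarith
  rw [hfactor]
  exact ⟨le_mul_of_one_le_left (sub_nonneg.2 huv) (le_add_of_nonneg_right (by positivity)),
    mul_le_mul_of_nonneg_right (by nlinarith) (sub_nonneg.2 huv)⟩

lemma penalty_sub_le {a : ℝ} (hc₂ : 0 < c₂) (hA : 0 < A) (hu : u ∈ Set.Icc 0 A)
    (hv : v ∈ Set.Icc 0 A) (ha : 0 ≤ a) (hvu : v - u ≤ a) :
    penalty c₂ A v - penalty c₂ A u ≤ (1 + 2 * c₂) * a := by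
  rcases le_total u v with huv | huv
  · exact (penalty_sub_mem_Icc hc₂ hA hu.1 huv hv.2).2.trans (by gcongr)
  · have := (penalty_sub_mem_Icc hc₂ hA hv.1 huv hu.2).1
    have : 0 ≤ (1 + 2 * c₂) * a := by positivity
    linarith

lemma sq_le_of_mul_sq_le {c K K' e G : ℝ} (hc : 0 < c)
    (h : c * G ^ 2 ≤ K * (e * G) + K' * e ^ 2) :
    G ^ 2 ≤ (K ^ 2 / c ^ 2 + 2 * K' / c) * e ^ 2 := by
  have hsq : 2 / c * (K * (e * G) + K' * e ^ 2) =
      (K ^ 2 / c ^ 2 + 2 * K' / c) * e ^ 2 + G ^ 2 - (G - K * e / c) ^ 2 := by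
    field_simp
    ring
  have hmul : 2 * G ^ 2 ≤ 2 / c * (K * (e * G) + K' * e ^ 2) := by
    calc 2 * G ^ 2 = 2 / c * (c * G ^ 2) := by field_simp
      _ ≤ _ := by gcongr
  linarith [sq_nonneg (G - K * e / c)]

/-- The lasso argument: when `τ` dominates the noise level `K`, an increase of the `ℓ₁` norm costs
more in the penalty than it gains through the statistical error. Here `l`, `m` and `n` are the
rescaled `ℓ₁` norms of the target, of the competitor and of the selected vector. -/
lemma mul_sq_le_of_penalty {G e τ a c K K' l m n ν : ℝ} (hc₂ : 0 < c₂) (hA : 0 < A) (hG : 0 ≤ G)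
    (he : 0 ≤ e) (hK : 0 ≤ K) (hKτ : K ≤ τ) (ha : 0 ≤ a) (hl : l ∈ Set.Icc 0 A)
    (hm : m ∈ Set.Icc 0 A) (hn : n ∈ Set.Icc 0 A) (hml : m - l ≤ a * e) (hln : l - n ≤ G)
    (hν : ν ≤ 3 * G + (n - l))
    (h : c * G ^ 2 + τ * e * (penalty c₂ A n - penalty c₂ A m) ≤ K * (e * ν) + K' * e ^ 2) :
    c * G ^ 2 ≤ (3 * K + τ * (1 + 2 * c₂)) * (e * G) + (K' + τ * a * (1 + 2 * c₂)) * e ^ 2 := by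
  have hτ := hK.trans hKτ
  have competitor := penalty_sub_le hc₂ hA hl hm (by positivity) hml
  have selected : K * (n - l) - τ * (penalty c₂ A n - penalty c₂ A l) ≤
      τ * (1 + 2 * c₂) * G := by
    rcases le_total l n with hle | hle
    · have hpen := (penalty_sub_mem_Icc hc₂ hA hl.1 hle hn.2).1
      have : 0 ≤ τ * (1 + 2 * c₂) * G := by positivity
      linarith [mul_le_mul hKτ hpen (sub_nonneg.2 hle) hτ]
    · have hpen := penalty_sub_le hc₂ hA hn hl hG hln
      linarith [mul_le_mul_of_nonneg_left hpen hτ, mul_nonneg hK (sub_nonneg.2 hle)]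
  calc c * G ^ 2 ≤ K * (e * (3 * G + (n - l))) + K' * e ^ 2 -
        τ * e * (penalty c₂ A n - penalty c₂ A m) :=
        le_sub_iff_add_le.2 (h.trans (by gcongr))
    _ = 3 * K * (e * G) + K' * e ^ 2 + e * (K * (n - l) -
        τ * (penalty c₂ A n - penalty c₂ A l)) + τ * e * (penalty c₂ A m - penalty c₂ A l) := by
        ring
    _ ≤ 3 * K * (e * G) + K' * e ^ 2 + e * (τ * (1 + 2 * c₂) * G) +
        τ * e * ((1 + 2 * c₂) * (a * e)) := by gcongr
    _ = _ := by ring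

end Penalty

section Comparison

variable {p : ℕ} {S L S' L' : LinearMap.BilinForm ℝ (Vec p)} {x b w : Vec p}
  {M γ e A τ c₂ a : ℝ}

lemma div_sqrt_l0_mem_Icc (hx : ‖x‖ = 1) {ℓ : ℝ} (hℓ : 0 ≤ ℓ) (hℓA : ℓ ≤ A * √(l0 x : ℝ)) :
    ℓ / √(l0 x : ℝ) ∈ Set.Icc 0 A :=
  ⟨by positivity, (div_le_iff₀ (sqrt_l0_pos hx)).2 hℓA⟩

/-- The Rayleigh quotient of the forms `(S, L)` minus `τ` times the penalty on the `ℓ₁` norm, in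
units of the square root of the sparsity `s`. -/
def penalizedRayleigh (S L : LinearMap.BilinForm ℝ (Vec p)) (τ c₂ A : ℝ) (s : ℕ) (b : Vec p) : ℝ :=
  S b b / L b b - τ * penalty c₂ A (l1 b / √(s : ℝ))

lemma IsLeading.sq_norm_sub_le_of_penalized (h : IsLeading S L x M γ)
    (hS : IsClose (mixedNorm (l0 x)) e S S') (hL : IsClose (mixedNorm (l0 x)) e L L')
    (he : 0 ≤ e) (hA : 1 ≤ A) (hsmall : 4 * (1 + A) ^ 2 * e ≤ 1 / (2 * M)) (hc₂ : 0 < c₂)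
    (ha : 0 ≤ a) (hτ : recenteringConst M A ≤ τ) (hb : b ∈ feasible p (A * √(l0 x : ℝ)))
    (hw : w ∈ feasible p (A * √(l0 x : ℝ))) (hbx : ‖b - x‖ ^ 2 ≤ 2) (hwx : ‖w - x‖ ≤ a * e)
    (hwℓ : (l1 w - l1 x) / √(l0 x : ℝ) ≤ a * e)
    (hcomp : penalizedRayleigh S' L' (τ * e) c₂ A (l0 x) w ≤
      penalizedRayleigh S' L' (τ * e) c₂ A (l0 x) b) :
    ‖b - x‖ ^ 2 ≤ ((3 * recenteringConst M A + τ * (1 + 2 * c₂)) ^ 2 / (γ / (4 * M ^ 2)) ^ 2 +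
      2 * (4 * recenteringConst M A * a + 2 * M ^ 2 * a ^ 2 + τ * a * (1 + 2 * c₂)) /
        (γ / (4 * M ^ 2))) * e ^ 2 := by
  rw [penalizedRayleigh, penalizedRayleigh] at hcomp
  have hM := h.const_pos
  have hγ := h.gap_pos
  have hs := sqrt_l0_pos h.norm_eq
  have hA_pos : 0 < A := by linarith
  have hK : 0 ≤ recenteringConst M A := by rw [recenteringConst]; positivity
  have upper := h.rayleigh_sub_le hS hL he hA hsmall hb hbx
  have lower : S' x x / L' x x - S' w w / L' w w ≤
      (4 * recenteringConst M A * a + 2 * M ^ 2 * a ^ 2) * e ^ 2 := by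
    have hwN : mixedNorm (l0 x) (w - x) ≤ 4 * (a * e) :=
      (mixedNorm_sub_le h.norm_eq).trans (by linarith)
    calc _ ≤ recenteringConst M A * (e * mixedNorm (l0 x) (w - x)) + 2 * M ^ 2 * ‖w - x‖ ^ 2 :=
          h.sub_rayleigh_le hS hL he hA hsmall hw
      _ ≤ recenteringConst M A * (e * (4 * (a * e))) + 2 * M ^ 2 * (a * e) ^ 2 := by gcongr
      _ = _ := by ring
  have hx1 : l1 x ≤ A * √(l0 x : ℝ) := by
    have := l1_le_sqrt_l0 x
    rw [h.norm_eq, mul_one] at this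
    exact this.trans (le_mul_of_one_le_left hs.le hA)
  refine sq_le_of_mul_sq_le (by positivity) (mul_sq_le_of_penalty hc₂ hA_pos (norm_nonneg _) he hK
    hτ ha (div_sqrt_l0_mem_Icc h.norm_eq (l1_nonneg x) hx1)
    (div_sqrt_l0_mem_Icc h.norm_eq (l1_nonneg w) hw.2)
    (div_sqrt_l0_mem_Icc h.norm_eq (l1_nonneg b) hb.2) ?_ ?_ (ν := mixedNorm (l0 x) (b - x)) ?_
    (by linarith))
  · rwa [← sub_div]
  · rw [← sub_div, div_le_iff₀ hs, mul_comm]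
    exact l1_sub_l1_le b x
  · rw [← sub_div]
    exact mixedNorm_sub_le h.norm_eq

end Comparison

end Penalized

section Sparse

variable {p s : ℕ}

/-- The vectors supported on `T`. -/
def supportedOn (T : Finset (Fin p)) : Submodule ℝ (Vec p) where
  carrier := {u | ∀ j ∉ T, u j = 0}
  add_mem' hu hv j hj := by simp [hu j hj, hv j hj]
  zero_mem' j _ := by simp
  smul_mem' c u hu j hj := by simp [hu j hj]

lemma supportedOn_mono {T U : Finset (Fin p)} (h : T ⊆ U) : supportedOn T ≤ supportedOn U :=
  fun _ hu j hj => hu j fun hT => hj (h hT)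

/-- The restriction of `u` to the coordinates in `T`, extended by zero. -/
def restrictTo (T : Finset (Fin p)) (u : Vec p) : Vec p :=
  WithLp.toLp 2 fun j => if j ∈ T then u j else 0

@[simp] lemma restrictTo_apply (T : Finset (Fin p)) (u : Vec p) (j : Fin p) :
    restrictTo T u j = if j ∈ T then u j else 0 := rfl

lemma restrictTo_mem (T : Finset (Fin p)) (u : Vec p) : restrictTo T u ∈ supportedOn T :=
  fun j hj => by simp [hj]

lemma restrictTo_compl_mem {T U : Finset (Fin p)} {u : Vec p} (hu : u ∈ supportedOn U) :
    restrictTo Tᶜ u ∈ supportedOn (U \ T) := fun j hj => by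
  by_cases hjT : j ∈ T
  · simp [hjT]
  · simp [hjT, hu j fun hjU => hj (Finset.mem_sdiff.2 ⟨hjU, hjT⟩)]

lemma sq_norm_restrictTo (T : Finset (Fin p)) (u : Vec p) :
    ‖restrictTo T u‖ ^ 2 = ∑ j ∈ T, u j ^ 2 := by
  rw [EuclideanSpace.norm_sq_eq]
  simp [Finset.sum_ite_mem, apply_ite (fun a : ℝ => a ^ 2)]

lemma norm_restrictTo_le (T : Finset (Fin p)) (u : Vec p) : ‖restrictTo T u‖ ≤ ‖u‖ := by
  apply le_of_sq_le_sq _ (norm_nonneg _)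
  rw [sq_norm_restrictTo, EuclideanSpace.real_norm_sq_eq]
  exact Finset.sum_le_univ_sum_of_nonneg fun _ => sq_nonneg _

lemma l1_restrictTo (T : Finset (Fin p)) (u : Vec p) : l1 (restrictTo T u) = ∑ j ∈ T, |u j| := by
  simp [l1, Finset.sum_ite_mem, apply_ite (fun a : ℝ => |a|)]

lemma restrictTo_add_compl (T : Finset (Fin p)) (u : Vec p) :
    restrictTo T u + restrictTo Tᶜ u = u := by
  ext j
  by_cases hj : j ∈ T <;> simp [hj]

lemma l1_restrictTo_add_compl (T : Finset (Fin p)) (u : Vec p) :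
    l1 (restrictTo T u) + l1 (restrictTo Tᶜ u) = l1 u := by
  rw [l1_restrictTo, l1_restrictTo, Finset.sum_add_sum_compl, l1]

lemma norm_le_of_abs_le {T : Finset (Fin p)} {u : Vec p} {m : ℝ} (hu : u ∈ supportedOn T)
    (hT : T.card ≤ s) (hm : 0 ≤ m) (h : ∀ j, |u j| ≤ m) : ‖u‖ ≤ √(s : ℝ) * m := by
  apply le_of_sq_le_sq _ (by positivity)
  rw [mul_pow, Real.sq_sqrt (Nat.cast_nonneg _), EuclideanSpace.norm_sq_eq]
  calc ∑ j, ‖u j‖ ^ 2 = ∑ j ∈ T, ‖u j‖ ^ 2 :=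
        (Finset.sum_subset (Finset.subset_univ _) fun j _ hj => by simp [hu j hj]).symm
    _ ≤ ∑ _j ∈ T, m ^ 2 := by
        gcongr with j
        exact h j
    _ = T.card * m ^ 2 := by simp
    _ ≤ s * m ^ 2 := by gcongr

lemma exists_largest_coordinates (u : Vec p) (U : Finset (Fin p)) (k : ℕ) (hk : k ≤ U.card) :
    ∃ T ⊆ U, T.card = k ∧ ∀ i ∈ T, ∀ j ∈ U \ T, |u j| ≤ |u i| := by
  induction k with
  | zero => exact ⟨∅, by simp, by simp, by simp⟩
  | succ k ih =>
    obtain ⟨T, hTU, hTk, hT⟩ := ih (by omega)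
    have hne : (U \ T).Nonempty := by
      rw [← Finset.card_pos, Finset.card_sdiff_of_subset hTU]
      omega
    obtain ⟨m, hm, hmax⟩ := Finset.exists_max_image (U \ T) (fun j => |u j|) hne
    obtain ⟨hmU, hmT⟩ := Finset.mem_sdiff.1 hm
    refine ⟨insert m T, Finset.insert_subset hmU hTU,
      by rw [Finset.card_insert_of_notMem hmT, hTk], fun i hi j hj => ?_⟩
    have hj' : j ∈ U \ T := Finset.sdiff_subset_sdiff_right _ (Finset.subset_insert m T) hj
    rcases Finset.mem_insert.1 hi with rfl | hi
    · exact hmax j hj'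
    · exact hT i hi j hj'

lemma abs_restrictTo_compl_le {u : Vec p} {U T : Finset (Fin p)} (hs : 0 < s)
    (hu : u ∈ supportedOn U) (hT : T.card = s) (h : ∀ i ∈ T, ∀ j ∈ U \ T, |u j| ≤ |u i|)
    (j : Fin p) : |restrictTo Tᶜ u j| ≤ l1 (restrictTo T u) / s := by
  have hs' : (0 : ℝ) < s := Nat.cast_pos.2 hs
  by_cases hj : j ∈ U \ T
  · rw [restrictTo_apply, if_pos (Finset.mem_compl.2 (Finset.mem_sdiff.1 hj).2), le_div_iff₀ hs',
      l1_restrictTo, mul_comm, ← hT, ← nsmul_eq_mul]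
    exact Finset.card_nsmul_le_sum _ _ _ fun i hi => h i hi j hj
  · rw [restrictTo_compl_mem hu j hj, abs_zero]
    exact div_nonneg (l1_nonneg _) hs'.le

section Subadditive

variable {F : Vec p → ℝ} {a : ℝ} (hF : ∀ u v, F (u + v) ≤ F u + F v) (hs : 0 < s) (ha : 0 ≤ a)
  (h : ∀ T : Finset (Fin p), T.card ≤ s → ∀ u ∈ supportedOn T, F u ≤ a * ‖u‖)
include hF hs ha h

/-- Splitting off the `s` largest coordinates leaves a vector bounded by their average, to which
the same bound applies. -/
lemma le_of_subadditive_of_abs_le {U : Finset (Fin p)} {u : Vec p} (hu : u ∈ supportedOn U)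
    {m : ℝ} (hm : 0 ≤ m) (hum : ∀ j, |u j| ≤ m) :
    F u ≤ a * (√(s : ℝ) * m + l1 u / √(s : ℝ)) := by
  induction U using Finset.strongInduction generalizing u m with
  | H U ih =>
    rcases le_or_gt U.card s with hU | hU
    · refine (h U hU u hu).trans (mul_le_mul_of_nonneg_left ?_ ha)
      exact (norm_le_of_abs_le hu hU hm hum).trans
        (le_add_of_nonneg_right (div_nonneg (l1_nonneg _) (Real.sqrt_nonneg _)))
    · obtain ⟨T, hTU, hTs, hT⟩ := exists_largest_coordinates u U s hU.le
      have head : F (restrictTo T u) ≤ a * (√(s : ℝ) * m) := by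
        refine (h T hTs.le _ (restrictTo_mem T u)).trans (mul_le_mul_of_nonneg_left ?_ ha)
        refine norm_le_of_abs_le (restrictTo_mem T u) hTs.le hm fun j => ?_
        rw [restrictTo_apply]
        split_ifs
        · exact hum j
        · simpa using hm
      have tail := ih (U \ T) (Finset.sdiff_ssubset hTU (Finset.card_pos.1 (hTs ▸ hs)))
        (restrictTo_compl_mem hu) (div_nonneg (l1_nonneg _) (Nat.cast_nonneg _))
        (abs_restrictTo_compl_le hs hu hTs hT)
      rw [mul_div_left_comm, Real.sqrt_div_self', mul_one_div, ← add_div,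
        l1_restrictTo_add_compl] at tail
      calc F u = F (restrictTo T u + restrictTo Tᶜ u) := by rw [restrictTo_add_compl]
        _ ≤ a * (√(s : ℝ) * m) + a * (l1 u / √(s : ℝ)) := (hF _ _).trans (add_le_add head tail)
        _ = _ := by ring

lemma le_mixedNorm_of_subadditive (u : Vec p) : F u ≤ a * mixedNorm s u := by
  have hu : u ∈ supportedOn (Finset.univ : Finset (Fin p)) :=
    fun j hj => absurd (Finset.mem_univ j) hj
  rcases le_or_gt (Finset.univ : Finset (Fin p)).card s with hp | hp
  · exact (h _ hp u hu).trans (mul_le_mul_of_nonneg_left (norm_le_mixedNorm s u) ha)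
  · obtain ⟨T, -, hTs, hT⟩ := exists_largest_coordinates u Finset.univ s hp.le
    have head : F (restrictTo T u) ≤ a * ‖u‖ := (h T hTs.le _ (restrictTo_mem T u)).trans
      (mul_le_mul_of_nonneg_left (norm_restrictTo_le T u) ha)
    have tail := le_of_subadditive_of_abs_le hF hs ha h (restrictTo_mem Tᶜ u)
      (div_nonneg (l1_nonneg _) (Nat.cast_nonneg _)) (abs_restrictTo_compl_le hs hu hTs hT)
    rw [mul_div_left_comm, Real.sqrt_div_self', mul_one_div, ← add_div,
      l1_restrictTo_add_compl] at tail
    calc F u = F (restrictTo T u + restrictTo Tᶜ u) := by rw [restrictTo_add_compl]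
      _ ≤ a * ‖u‖ + a * (l1 u / √(s : ℝ)) := (hF _ _).trans (add_le_add head tail)
      _ = _ := by rw [mixedNorm_apply, mul_add]

end Subadditive

lemma abs_apply_le_mixedNorm_of_sparse {B : LinearMap.BilinForm ℝ (Vec p)} (hB : B.IsSymm)
    (hs : 0 < s) {a : ℝ} (ha : 0 ≤ a) (h : ∀ T : Finset (Fin p), T.card ≤ 2 * s →
      ∀ u ∈ supportedOn T, |B u u| ≤ a * ‖u‖ ^ 2) (u v : Vec p) :
    |B u v| ≤ a * (mixedNorm s u * mixedNorm s v) := by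
  have sparse : ∀ T : Finset (Fin p), T.card ≤ s → ∀ v ∈ supportedOn T, ∀ u : Vec p,
      |B u v| ≤ a * ‖v‖ * mixedNorm s u := by
    intro T hT v hv u
    refine le_mixedNorm_of_subadditive (F := fun u => |B u v|) (fun u w => ?_) hs
      (by positivity) (fun U hU u hu => ?_) u
    · simpa using abs_add_le (B u v) (B w v)
    · have hc : (T ∪ U).card ≤ 2 * s := (Finset.card_union_le _ _).trans (by omega)
      exact (abs_apply_le_of_abs_apply_self_le hB (supportedOn (T ∪ U)) (h _ hc)
        (supportedOn_mono Finset.subset_union_right hu)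
        (supportedOn_mono Finset.subset_union_left hv)).trans_eq (by ring)
  refine (le_mixedNorm_of_subadditive (F := fun v => |B u v|) (a := a * mixedNorm s u)
    (fun v w => by simpa using abs_add_le (B u v) (B u w)) hs (by positivity)
    (fun T hT v hv => (sparse T hT v hv u).trans_eq (by ring)) v).trans_eq (by ring)

end Sparse

section Quadratic

variable {E : Type*} [NormedAddCommGroup E] [InnerProductSpace ℝ E]
  {B : LinearMap.BilinForm ℝ E} {P : Submodule ℝ E}

lemma abs_apply_self_le_of_unit {a : ℝ} (h : ∀ z ∈ P, ‖z‖ = 1 → |B z z| ≤ a) {u : E}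
    (hu : u ∈ P) : |B u u| ≤ a * ‖u‖ ^ 2 := by
  rcases eq_or_ne u 0 with rfl | hu0
  · simp
  have : 0 < ‖u‖ := norm_pos_iff.2 hu0
  have hz := h (‖u‖⁻¹ • u) (P.smul_mem _ hu) (norm_smul_inv_norm hu0)
  rw [map_smul, map_smul, LinearMap.smul_apply, smul_smul, smul_eq_mul, abs_mul,
    abs_of_pos (by positivity)] at hz
  calc |B u u| = ‖u‖⁻¹ * ‖u‖⁻¹ * |B u u| * ‖u‖ ^ 2 := by field_simp
    _ ≤ a * ‖u‖ ^ 2 := by gcongr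

lemma exists_forall_abs_apply_self_le [FiniteDimensional ℝ E] (B : LinearMap.BilinForm ℝ E)
    (hP : P ≠ ⊥) : ∃ z ∈ P, ‖z‖ = 1 ∧ ∀ u ∈ P, |B u u| ≤ |B z z| * ‖u‖ ^ 2 := by
  obtain ⟨u, hu, hu0⟩ := P.exists_mem_ne_zero_of_ne_bot hP
  have compact : IsCompact (Metric.sphere (0 : E) 1 ∩ P) :=
    (isCompact_sphere 0 1).inter_right P.closed_of_finiteDimensional
  have nonempty : (Metric.sphere (0 : E) 1 ∩ P).Nonempty :=
    ⟨‖u‖⁻¹ • u, mem_sphere_zero_iff_norm.2 (norm_smul_inv_norm hu0), P.smul_mem _ hu⟩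
  have cont : Continuous fun u => |B u u| :=
    (B.toContinuousBilinearMap.continuous.clm_apply continuous_id).abs
  obtain ⟨z, ⟨hz, hzP⟩, hmax⟩ := compact.exists_isMaxOn nonempty cont.continuousOn
  exact ⟨z, hzP, mem_sphere_zero_iff_norm.1 hz, fun u => abs_apply_self_le_of_unit
    fun w hw hw1 => hmax ⟨mem_sphere_zero_iff_norm.2 hw1, hw⟩⟩

/-- At a unit vector `u` maximizing `|B u u|`, polarization of `B u u - B v v` absorbs the error
of replacing `u` by `v`. -/
lemma abs_apply_self_le_of_net [FiniteDimensional ℝ E] (hB : B.IsSymm) {b : ℝ}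
    (h : ∀ u ∈ P, ‖u‖ = 1 → ∃ v ∈ P, ‖u - v‖ ≤ 1 / 4 ∧ |B v v| ≤ b * ‖v‖ ^ 2) {u : E}
    (hu : u ∈ P) : |B u u| ≤ 4 * b * ‖u‖ ^ 2 := by
  rcases eq_or_ne u 0 with rfl | hu0
  · simp
  obtain ⟨z, hz, hz1, hmax⟩ :=
    exists_forall_abs_apply_self_le B ((Submodule.ne_bot_iff P).2 ⟨u, hu, hu0⟩)
  obtain ⟨v, hv, hzv, hvb⟩ := h z hz hz1
  have hvn : ‖v‖ ∈ Set.Icc (3 / 4) (5 / 4) := by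
    have h₁ := norm_sub_norm_le z v
    have h₂ := norm_sub_norm_le v z
    rw [norm_sub_rev] at h₂
    exact ⟨by linarith, by linarith⟩
  have hb : 0 ≤ b := nonneg_of_mul_nonneg_left ((abs_nonneg _).trans hvb)
    (pow_pos (by linarith [hvn.1]) 2)
  have polarization : B z z = B (z - v) (z + v) + B v v := by
    simp only [map_sub, map_add, LinearMap.sub_apply, hB.eq z v]
    ring
  have max_le : |B z z| ≤ |B z z| * (1 / 4 * (9 / 4)) + b * (5 / 4) ^ 2 := by
    nth_rw 1 [polarization]
    refine (abs_add_le _ _).trans (add_le_add ?_ (hvb.trans ?_))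
    · refine (abs_apply_le_of_abs_apply_self_le hB P hmax (P.sub_mem hz hv)
        (P.add_mem hz hv)).trans ?_
      gcongr
      exact (norm_add_le _ _).trans (by linarith [hvn.2])
    · gcongr
      exact hvn.2
  exact (hmax u hu).trans (by gcongr; linarith)

end Quadratic

section Net

variable {p k : ℕ}

open Classical in
/-- A net of the unit vectors with at most `k` nonzero coordinates: the vectors with at most `k`
nonzero coordinates, and these in `m⁻¹ℤ ∩ [-1, 1]`, are sums of `k` vectors `(a / m) • eⱼ`. -/
def net (p m : ℕ) : ℕ → Finset (Vec p)
  | 0 => {0}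
  | k + 1 => (net p m k ×ˢ Finset.univ ×ˢ Finset.Icc (-m : ℤ) m).image fun q =>
      q.1 + EuclideanSpace.single q.2.1 ((q.2.2 : ℝ) / m)

lemma card_net_le (p m k : ℕ) : (net p m k).card ≤ (p * (2 * m + 1)) ^ k := by
  induction k with
  | zero => simp [net]
  | succ k ih =>
    have hm : (m + 1 + m : ℤ).toNat = 2 * m + 1 := by omega
    calc (net p m (k + 1)).card
        ≤ (net p m k ×ˢ (Finset.univ : Finset (Fin p)) ×ˢ Finset.Icc (-m : ℤ) m).card :=
          Finset.card_image_le
      _ = (net p m k).card * (p * (2 * m + 1)) := by simp [hm]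
      _ ≤ (p * (2 * m + 1)) ^ (k + 1) := by rw [pow_succ]; gcongr

lemma card_net_le_exp {s : ℕ} (hsp : s ≤ p) (hp : 2 ≤ p) :
    ((net p (2 * (2 * s)) (2 * s)).card : ℝ) ≤ Real.exp (12 * (s * Real.log p)) := by
  have base : p * (2 * (2 * (2 * s)) + 1) ≤ p ^ 6 := by
    have : 2 ^ 4 ≤ p ^ 4 := Nat.pow_le_pow_left hp 4
    calc p * (2 * (2 * (2 * s)) + 1) ≤ p * (2 ^ 4 * p) := by gcongr; omega
      _ ≤ p * (p ^ 4 * p) := by gcongr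
      _ = p ^ 6 := by ring
  have card : (net p (2 * (2 * s)) (2 * s)).card ≤ p ^ (12 * s) :=
    calc _ ≤ (p * (2 * (2 * (2 * s)) + 1)) ^ (2 * s) := card_net_le _ _ _
      _ ≤ (p ^ 6) ^ (2 * s) := Nat.pow_le_pow_left base _
      _ = p ^ (12 * s) := by rw [← pow_mul]; congr 1; ring
  calc ((net p (2 * (2 * s)) (2 * s)).card : ℝ) ≤ (p : ℝ) ^ (12 * s) := mod_cast card
    _ = Real.exp (12 * (s * Real.log p)) := by
      rw [← Real.exp_log (show (0 : ℝ) < p by positivity), ← Real.exp_nat_mul, Real.log_exp]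
      push_cast
      ring_nf

lemma mem_net {m : ℕ} (hp : 0 < p) {T : Finset (Fin p)} (hT : T.card ≤ k) {v : Vec p}
    (hv : v ∈ supportedOn T) (hgrid : ∀ j, ∃ a ∈ Finset.Icc (-m : ℤ) m, v j = a / m) :
    v ∈ net p m k := by
  induction k generalizing T v with
  | zero =>
    have : v = 0 := PiLp.ext fun j => hv j (by simp [Finset.card_eq_zero.1 (Nat.le_zero.1 hT)])
    simp [net, this]
  | succ k ih =>
    obtain ⟨j, hj⟩ : ∃ j : Fin p, (T.erase j).card ≤ k := by
      rcases T.eq_empty_or_nonempty with rfl | ⟨j, hj⟩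
      · exact ⟨⟨0, hp⟩, by simp⟩
      · exact ⟨j, by rw [Finset.card_erase_of_mem hj]; omega⟩
    obtain ⟨a, ha, hva⟩ := hgrid j
    have tail : restrictTo {j}ᶜ v ∈ net p m k := by
      refine ih hj ?_ fun i => ?_
      · rw [Finset.erase_eq]
        exact restrictTo_compl_mem hv
      · by_cases hij : i = j
        · exact ⟨0, by simp, by simp [hij]⟩
        · simpa [hij] using hgrid i
    refine Finset.mem_image.2 ⟨(restrictTo {j}ᶜ v, j, a), by simp [tail, Finset.mem_Icc.1 ha],
      PiLp.ext fun i => ?_⟩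
    by_cases hij : i = j
    · simp [hij, hva]
    · simp [hij]

lemma abs_sub_round_mul_div_le {m : ℝ} (hm : 0 < m) (x : ℝ) :
    |x - round (m * x) / m| ≤ 1 / (2 * m) := by
  have h : x - round (m * x) / m = (m * x - round (m * x)) / m := by field_simp
  rw [h, abs_div, abs_of_pos hm, div_le_iff₀ hm]
  exact (abs_sub_round _).trans_eq (by field_simp)

lemma round_mul_mem_Icc {x : ℝ} (hx : |x| ≤ 1) (m : ℕ) :
    round ((m : ℝ) * x) ∈ Finset.Icc (-m : ℤ) m := by
  obtain ⟨h₁, h₂⟩ := abs_le.1 hx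
  have : (0 : ℝ) ≤ m := Nat.cast_nonneg m
  obtain ⟨h₃, h₄⟩ := abs_le.1 (abs_sub_round ((m : ℝ) * x))
  have lower : (-(m + 1 : ℤ) : ℝ) < round ((m : ℝ) * x) := by push_cast; nlinarith
  have upper : (round ((m : ℝ) * x) : ℝ) < (m + 1 : ℤ) := by push_cast; nlinarith
  have h₅ : -(m + 1 : ℤ) < round ((m : ℝ) * x) := by exact_mod_cast lower
  have h₆ : round ((m : ℝ) * x) < (m + 1 : ℤ) := by exact_mod_cast upper
  rw [Finset.mem_Icc]
  omega

lemma exists_net_close (hk : 0 < k) (hp : 0 < p) {T : Finset (Fin p)} (hT : T.card ≤ k)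
    {u : Vec p} (hu : u ∈ supportedOn T) (hu1 : ‖u‖ = 1) :
    ∃ v ∈ net p (2 * k) k, v ∈ supportedOn T ∧ ‖u - v‖ ≤ 1 / 4 := by
  have hk' : (1 : ℝ) ≤ k := Nat.one_le_cast.2 hk
  set v : Vec p := WithLp.toLp 2 fun j => (round (((2 * k : ℕ) : ℝ) * u j) : ℝ) / (2 * k : ℕ)
    with hv
  have hvT : v ∈ supportedOn T := fun j hj => by simp [hv, hu j hj]
  have coordinate_le (j : Fin p) : |u j| ≤ 1 := hu1 ▸ PiLp.norm_apply_le u j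
  refine ⟨v, mem_net hp hT hvT fun j => ⟨_, round_mul_mem_Icc (coordinate_le j) _, rfl⟩, hvT, ?_⟩
  calc ‖u - v‖ ≤ √(k : ℝ) * (1 / (2 * (2 * k : ℕ))) :=
        norm_le_of_abs_le ((supportedOn T).sub_mem hu hvT) hT (by positivity)
          fun j => abs_sub_round_mul_div_le (by positivity) (u j)
    _ ≤ k * (1 / (2 * (2 * k : ℕ))) := by
        gcongr
        exact Real.sqrt_le_self_iff.2 (Or.inr hk')
    _ = 1 / 4 := by push_cast; field_simp; norm_num

lemma abs_sub_le_of_net {S S' : LinearMap.BilinForm ℝ (Vec p)} (hS : S.IsSymm) (hS' : S'.IsSymm)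
    (hk : 0 < k) (hp : 0 < p) {t K : ℝ} (ht : 0 ≤ t)
    (hnet : ∀ v ∈ net p (2 * k) k, |S' v v - S v v| ≤ t * S v v) {T : Finset (Fin p)}
    (hT : T.card ≤ k) (hK : ∀ u ∈ supportedOn T, S u u ≤ K * ‖u‖ ^ 2) {u : Vec p}
    (hu : u ∈ supportedOn T) : |S' u u - S u u| ≤ 4 * (t * K) * ‖u‖ ^ 2 := by
  refine abs_apply_self_le_of_net (B := S' - S) (hS'.sub hS) (fun u hu hu1 => ?_) hu
  obtain ⟨v, hvnet, hvT, huv⟩ := exists_net_close hk hp hT hu hu1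
  refine ⟨v, hvT, huv, (hnet v hvnet).trans ?_⟩
  rw [mul_assoc]
  exact mul_le_mul_of_nonneg_left (hK v hvT) ht

end Net

section Form

variable {p : ℕ}

/-- The bilinear form `uᵀ S v` of a matrix `S`. -/
def form : Matrix (Fin p) (Fin p) ℝ ≃ₗ[ℝ] LinearMap.BilinForm ℝ (Vec p) :=
  Matrix.toBilin (EuclideanSpace.basisFun (Fin p) ℝ).toBasis

variable {S : Matrix (Fin p) (Fin p) ℝ}

lemma form_apply (S : Matrix (Fin p) (Fin p) ℝ) (u v : Vec p) :
    form S u v = ∑ i, ∑ j, u i * S i j * v j := by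
  simp [form, Matrix.toBilin_apply]

lemma form_eq_dotProduct (S : Matrix (Fin p) (Fin p) ℝ) (u v : Vec p) :
    form S u v = u.ofLp ⬝ᵥ S.mulVec v.ofLp := by
  simp [form_apply, dotProduct, Matrix.mulVec, Finset.mul_sum, mul_assoc]

lemma quad_eq_form (S : Matrix (Fin p) (Fin p) ℝ) (u : Vec p) : quad S u = form S u u :=
  (form_eq_dotProduct S u u).symm

lemma isSymm_form (hS : S.IsSymm) : (form S).IsSymm :=
  (Matrix.isSymm_toBilin_iff_isSymm _).2 hS

lemma isPosSemidef_form (hS : S.PosSemidef) : (form S).IsPosSemidef where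
  eq := (isSymm_form (Matrix.isHermitian_iff_isSymm.1 hS.isHermitian)).eq
  nonneg u := by
    simpa only [form_eq_dotProduct, star_trivial] using hS.dotProduct_mulVec_nonneg u.ofLp

open scoped MatrixOrder in
lemma dotProduct_mulVec_mem_Icc {ι : Type*} [Fintype ι] [DecidableEq ι] {A : Matrix ι ι ℝ}
    (hA : A.IsHermitian) {a b : ℝ} (h : spectrum ℝ A ⊆ Set.Icc a b) (w : ι → ℝ) :
    w ⬝ᵥ A.mulVec w ∈ Set.Icc (a * (w ⬝ᵥ w)) (b * (w ⬝ᵥ w)) := by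
  have scalar (c : ℝ) : w ⬝ᵥ (algebraMap ℝ (Matrix ι ι ℝ) c).mulVec w = c * (w ⬝ᵥ w) := by
    rw [Algebra.algebraMap_eq_smul_one, Matrix.smul_mulVec, Matrix.one_mulVec, dotProduct_smul,
      smul_eq_mul]
  have mono {A B : Matrix ι ι ℝ} (hAB : A ≤ B) : w ⬝ᵥ A.mulVec w ≤ w ⬝ᵥ B.mulVec w := by
    simpa [Matrix.sub_mulVec, dotProduct_sub] using
      (Matrix.le_iff.1 hAB).dotProduct_mulVec_nonneg w
  rw [← scalar a, ← scalar b]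
  exact ⟨mono (algebraMap_le_of_le_spectrum (fun x hx => (h hx).1) hA.isSelfAdjoint),
    mono (le_algebraMap_of_spectrum_le (fun x hx => (h hx).2) hA.isSelfAdjoint)⟩

end Form

section Blocks

variable {p D : ℕ} {blk : Fin p → Fin D} {S S' : Matrix (Fin p) (Fin p) ℝ}

/-- The set of features of the block `d`. -/
def block (blk : Fin p → Fin D) (d : Fin D) : Finset (Fin p) :=
  Finset.univ.filter fun j => blk j = d

@[simp] lemma mem_block {d : Fin D} {j : Fin p} : j ∈ block blk d ↔ blk j = d := by simp [block]

lemma isSymm_blockPart (hS : S.IsSymm) : (blockPart blk S).IsSymm := by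
  ext i j
  simp only [Matrix.transpose_apply, blockPart, Matrix.of_apply, hS.apply i j, eq_comm]

lemma form_blockPart (blk : Fin p → Fin D) (S : Matrix (Fin p) (Fin p) ℝ) (u v : Vec p) :
    form (blockPart blk S) u v =
      ∑ d, form S (restrictTo (block blk d) u) (restrictTo (block blk d) v) := by
  simp only [form_apply]
  symm
  rw [Finset.sum_comm]
  refine Finset.sum_congr rfl fun i _ => ?_
  rw [Finset.sum_comm]
  refine Finset.sum_congr rfl fun j _ => ?_
  simp [blockPart]

lemma sum_sq_norm_restrictTo_block (blk : Fin p → Fin D) (u : Vec p) :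
    ∑ d, ‖restrictTo (block blk d) u‖ ^ 2 = ‖u‖ ^ 2 := by
  simp_rw [sq_norm_restrictTo, EuclideanSpace.real_norm_sq_eq, block]
  exact Finset.sum_fiberwise Finset.univ blk fun j => u j ^ 2

lemma form_blockPart_of_mem {d : Fin D} {u v : Vec p} (hu : u ∈ supportedOn (block blk d))
    (hv : v ∈ supportedOn (block blk d)) : form (blockPart blk S) u v = form S u v := by
  simp only [form_apply]
  refine Finset.sum_congr rfl fun i _ => Finset.sum_congr rfl fun j _ => ?_
  by_cases hi : i ∈ block blk d
  · by_cases hj : j ∈ block blk d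
    · simp [blockPart, mem_block.1 hi, mem_block.1 hj]
    · simp [hv j hj]
  · simp [hu i hi]

lemma form_restrictTo_block (S : Matrix (Fin p) (Fin p) ℝ) (d : Fin D) (u : Vec p) :
    form S (restrictTo (block blk d) u) (restrictTo (block blk d) u) =
      (fun j : {j // blk j = d} => u j) ⬝ᵥ
        (blockOf blk S d).mulVec (fun j : {j // blk j = d} => u j) := by
  have sum_subtype (f : Fin p → ℝ) : ∑ j, (if blk j = d then f j else 0) =
      ∑ j : {j // blk j = d}, f j := by
    rw [← Finset.sum_filter]
    exact Finset.sum_subtype _ (by simp) f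
  simp only [dotProduct, Matrix.mulVec, blockOf, Matrix.submatrix_apply, Finset.mul_sum]
  rw [form_apply, ← sum_subtype fun i => ∑ j : {j // blk j = d}, u i * (S i j * u j)]
  refine Finset.sum_congr rfl fun i _ => ?_
  rw [← sum_subtype fun j => u i * (S i j * u j)]
  split_ifs with hi
  · simp [hi, mul_assoc]
  · simp [hi]

lemma sq_norm_restrictTo_block (d : Fin D) (u : Vec p) : ‖restrictTo (block blk d) u‖ ^ 2 =
    (fun j : {j // blk j = d} => u j) ⬝ᵥ (fun j : {j // blk j = d} => u j) := by
  rw [sq_norm_restrictTo]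
  simp only [dotProduct, pow_two]
  exact Finset.sum_subtype _ (by simp) fun j => u j * u j

lemma form_blockPart_mem_Icc (hS : S.IsHermitian) {a b : ℝ}
    (h : ∀ d, spectrum ℝ (blockOf blk S d) ⊆ Set.Icc a b) (u : Vec p) :
    form (blockPart blk S) u u ∈ Set.Icc (a * ‖u‖ ^ 2) (b * ‖u‖ ^ 2) := by
  have hd (d : Fin D) := dotProduct_mulVec_mem_Icc (hS.submatrix _) (h d)
    fun j : {j // blk j = d} => u j
  simp only [form_blockPart, ← sum_sq_norm_restrictTo_block blk u, Finset.mul_sum,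
    form_restrictTo_block, sq_norm_restrictTo_block]
  exact ⟨Finset.sum_le_sum fun d _ => (hd d).1, Finset.sum_le_sum fun d _ => (hd d).2⟩

variable {s : ℕ} {t K : ℝ}

lemma isClose_of_net (hS : S.IsSymm) (hS' : S'.IsSymm) (hs : 0 < s) (hp : 0 < p) (ht : 0 ≤ t)
    (hK : 0 ≤ K)
    (hnet : ∀ v ∈ net p (2 * (2 * s)) (2 * s), |form S' v v - form S v v| ≤ t * form S v v)
    (h : ∀ u, form S u u ≤ K * ‖u‖ ^ 2) :
    IsClose (mixedNorm s) (4 * (t * K)) (form S) (form S') := fun u v =>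
  abs_apply_le_mixedNorm_of_sparse ((isSymm_form hS').sub (isSymm_form hS)) hs (by positivity)
    (fun _ hT _ hu => abs_sub_le_of_net (isSymm_form hS) (isSymm_form hS') (by omega) hp ht hnet hT
      (fun w _ => h w) hu) u v

lemma isClose_blockPart_of_net (hS : S.IsSymm) (hS' : S'.IsSymm) (hs : 0 < s) (hp : 0 < p)
    (ht : 0 ≤ t) (hK : 0 ≤ K)
    (hnet : ∀ v ∈ net p (2 * (2 * s)) (2 * s), |form S' v v - form S v v| ≤ t * form S v v)
    (h : ∀ u, form (blockPart blk S) u u ≤ K * ‖u‖ ^ 2) :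
    IsClose (mixedNorm s) (4 * (t * K)) (form (blockPart blk S)) (form (blockPart blk S')) := by
  refine fun u v => abs_apply_le_mixedNorm_of_sparse ((isSymm_form (isSymm_blockPart hS')).sub
    (isSymm_form (isSymm_blockPart hS))) hs (by positivity) (fun T hT w hw => ?_) u v
  simp only [LinearMap.sub_apply, form_blockPart, ← Finset.sum_sub_distrib,
    ← sum_sq_norm_restrictTo_block blk w, Finset.mul_sum]
  refine (Finset.abs_sum_le_sum_abs _ _).trans (Finset.sum_le_sum fun d _ => ?_)
  refine abs_sub_le_of_net (T := T ∩ block blk d) (isSymm_form hS) (isSymm_form hS') (by omega) hp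
    ht hnet ((Finset.card_le_card Finset.inter_subset_left).trans hT) (fun u hu => ?_)
    fun j hj => ?_
  · have hu' := supportedOn_mono Finset.inter_subset_right hu
    rw [← form_blockPart_of_mem hu' hu']
    exact h u
  · rw [restrictTo_apply, ite_eq_right_iff]
    exact fun hjd => hw j fun hjT => hj (Finset.mem_inter.2 ⟨hjT, hjd⟩)

end Blocks

section Population

lemma apply_eq_of_forall_apply_self_le {E : Type*} [AddCommGroup E] [Module ℝ E]
    {S L : LinearMap.BilinForm ℝ E} (hS : S.IsSymm) (hL : L.IsSymm) {x : E}
    (h : ∀ u, S u u ≤ L u u) (hx : S x x = L x x) (v : E) : S v x = L v x := by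
  have key := (L - S).apply_sq_le_of_symm (fun u => by simpa using h u)
    (LinearMap.BilinForm.isSymm_iff.1 (hL.sub hS)) v x
  simp only [LinearMap.sub_apply, hx, sub_self, mul_zero] at key
  exact (sub_eq_zero.1 (pow_eq_zero_iff two_ne_zero |>.1 (key.antisymm (sq_nonneg _)))).symm

variable {p D : ℕ} {blk : Fin p → Fin D} {S L : Matrix (Fin p) (Fin p) ℝ} {ξ : ℕ → Vec p}
  {M γ C : ℝ}

lemma IsDirections.form_le (h : IsDirections S L ξ) (hL : ∀ u ≠ 0, 0 < form L u u) {j : ℕ}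
    (hj : j ∈ Finset.Icc 1 p) {u : Vec p} (hu : ∀ i ∈ Finset.Ico 1 j, form L u (ξ i) = 0) :
    form S u u ≤ rayleigh S L (ξ j) * form L u u := by
  rcases eq_or_ne u 0 with rfl | hu0
  · simp
  have hnorm : ‖u‖⁻¹ ≠ 0 := inv_ne_zero (norm_ne_zero_iff.2 hu0)
  have key := (h j hj).2 (‖u‖⁻¹ • u) ⟨norm_smul_inv_norm hu0, fun i hi => by
    rw [← form_eq_dotProduct, map_smul, LinearMap.smul_apply, hu i hi, smul_zero]⟩
  rwa [rayleigh, quad_eq_form, quad_eq_form, map_smul, map_smul, map_smul, LinearMap.smul_apply,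
    map_smul, LinearMap.smul_apply, smul_eq_mul, smul_eq_mul, smul_eq_mul, smul_eq_mul,
    mul_div_mul_left _ _ hnorm, mul_div_mul_left _ _ hnorm, div_le_iff₀ (hL u hu0)] at key

namespace IsPopulation

variable (h : IsPopulation blk S ξ M γ C)
include h

lemma isSymm : S.IsSymm := Matrix.isHermitian_iff_isSymm.1 h.posSemidef.isHermitian

lemma one_le_corr (hp : 0 < p) : 1 ≤ corr blk S ξ 1 := by
  have j : Fin p := ⟨0, hp⟩
  have basis (A : Matrix (Fin p) (Fin p) ℝ) : quad A (EuclideanSpace.single j 1) = A j j := by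
    simp [quad_eq_form, form_apply]
  have key := (h.directions 1 (Finset.mem_Icc.2 ⟨le_rfl, hp⟩)).2 (EuclideanSpace.single j 1)
    ⟨by simp, by simp⟩
  rwa [rayleigh, basis, basis, blockPart, Matrix.of_apply, if_pos rfl, h.diag_eq_one,
    div_one] at key

lemma sq_norm_le (hM : 0 < M) (u : Vec p) : ‖u‖ ^ 2 ≤ M * form (blockPart blk S) u u := by
  have := (form_blockPart_mem_Icc h.posSemidef.isHermitian h.block_spectrum u).1
  rwa [one_div, inv_mul_le_iff₀ hM] at this

lemma form_le (u : Vec p) : form (blockPart blk S) u u ≤ M * ‖u‖ ^ 2 :=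
  (form_blockPart_mem_Icc h.posSemidef.isHermitian h.block_spectrum u).2

lemma form_nonneg (hM : 0 < M) (u : Vec p) : 0 ≤ form (blockPart blk S) u u :=
  nonneg_of_mul_nonneg_right ((sq_nonneg _).trans (h.sq_norm_le hM u)) hM

lemma form_pos (hM : 0 < M) (u : Vec p) (hu : u ≠ 0) : 0 < form (blockPart blk S) u u :=
  pos_of_mul_pos_right ((pow_pos (norm_pos_iff.2 hu) 2).trans_le (h.sq_norm_le hM u)) hM.le

lemma form_le_corr_mul (hM : 0 < M) (hp : 0 < p) (u : Vec p) :
    form S u u ≤ corr blk S ξ 1 * form (blockPart blk S) u u :=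
  h.directions.form_le (h.form_pos hM) (Finset.mem_Icc.2 ⟨le_rfl, hp⟩) (by simp)

lemma isLeading (hM : 0 < M) (hγ : 0 < γ) (hp : 2 ≤ p) :
    IsLeading ((corr blk S ξ 1)⁻¹ • form S) (form (blockPart blk S)) (ξ 1) M γ := by
  have hρ : 0 < corr blk S ξ 1 := one_pos.trans_le (h.one_le_corr (by omega))
  have norm_eq : ‖ξ 1‖ = 1 := (h.directions 1 (Finset.mem_Icc.2 ⟨le_rfl, by omega⟩)).1.1
  have hξ : ξ 1 ≠ 0 := fun h0 => by simp [h0] at norm_eq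
  have posSemidef := (isPosSemidef_form h.posSemidef).smul (inv_nonneg.2 hρ.le)
  have symm := isSymm_form (isSymm_blockPart (blk := blk) h.isSymm)
  refine ⟨hM, hγ, posSemidef, symm, h.sq_norm_le hM, h.form_le, norm_eq,
    apply_eq_of_forall_apply_self_le posSemidef.isSymm symm (fun u => ?_) ?_, fun w hw => ?_⟩
  · exact (inv_mul_le_iff₀ hρ).2 (h.form_le_corr_mul hM (by omega) u)
  · rw [LinearMap.smul_apply, LinearMap.smul_apply, smul_eq_mul, inv_mul_eq_iff_eq_mul₀ hρ.ne',
      corr, rayleigh, quad_eq_form, quad_eq_form, div_mul_cancel₀ _ (h.form_pos hM _ hξ).ne']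
  · have admissible (i : ℕ) (hi : i ∈ Finset.Ico 1 2) : form (blockPart blk S) w (ξ i) = 0 := by
      obtain rfl : i = 1 := by simpa using hi
      exact hw
    have second : form S w w ≤ corr blk S ξ 2 * form (blockPart blk S) w w :=
      h.directions.form_le (h.form_pos hM) (Finset.mem_Icc.2 ⟨one_le_two, hp⟩) admissible
    refine (inv_mul_le_iff₀ hρ).2 (second.trans ?_)
    rw [← mul_assoc]
    exact mul_le_mul_of_nonneg_right (by linarith [h.gap]) (h.form_nonneg hM w)

end IsPopulation

end Population

section ChiSquare

open NNReal

lemma integral_exp_mul_sq_gaussianReal {v : ℝ≥0} (hv : v ≠ 0) {l : ℝ} (hl : 2 * l * v < 1) :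
    ∫ y, Real.exp (l * y ^ 2) ∂(gaussianReal 0 v) = (√(1 - 2 * l * v))⁻¹ := by
  have : (0 : ℝ) < v := NNReal.coe_pos.2 hv.pos
  have : 0 < 1 - 2 * l * v := by linarith
  have density (y : ℝ) : gaussianPDFReal 0 v y • Real.exp (l * y ^ 2) =
      (√(2 * Real.pi * v))⁻¹ * Real.exp (-((1 - 2 * l * v) / (2 * v)) * y ^ 2) := by
    rw [gaussianPDFReal, smul_eq_mul, mul_assoc, ← Real.exp_add]
    congr 2
    field_simp
    ring
  simp_rw [integral_gaussianReal_eq_integral_smul hv, density]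
  rw [integral_const_mul, integral_gaussian, ← Real.sqrt_inv, ← Real.sqrt_inv,
    ← Real.sqrt_mul (by positivity)]
  congr 1
  field_simp

lemma exp_neg_sub_sq_le {z : ℝ} (hz : |z| ≤ 1 / 2) : Real.exp (-z - z ^ 2) ≤ 1 - z := by
  obtain ⟨hz₁, hz₂⟩ := abs_le.1 hz
  rcases le_total 0 z with h0 | h0
  · have quadratic := Real.quadratic_le_exp_of_nonneg (show 0 ≤ z + z ^ 2 by positivity)
    rw [← neg_add', Real.exp_neg, inv_le_iff_one_le_mul₀ (Real.exp_pos _)]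
    have cubic : 0 ≤ z ^ 2 / 2 * (1 - z - z ^ 2 - z ^ 3) := by
      have h₂ : z ^ 2 ≤ (1 / 2) ^ 2 := by gcongr
      have h₃ : z ^ 3 ≤ (1 / 2) ^ 3 := by gcongr
      exact mul_nonneg (by positivity) (by linarith)
    nlinarith [mul_le_mul_of_nonneg_right quadratic (show 0 ≤ 1 - z by linarith)]
  · have remainder := (abs_le.1 (Real.abs_exp_sub_one_sub_id_le (x := -z - z ^ 2)
      (abs_le.2 ⟨by nlinarith, by nlinarith⟩))).2
    nlinarith [mul_nonneg (neg_nonneg.2 h0) (sq_nonneg z)]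

lemma inv_sqrt_one_sub_le {z : ℝ} (hz : |z| ≤ 1 / 2) :
    (√(1 - z))⁻¹ ≤ Real.exp (z / 2 + z ^ 2 / 2) := by
  have hz₂ := (abs_le.1 hz).2
  rw [inv_le_comm₀ (Real.sqrt_pos.2 (by linarith)) (Real.exp_pos _), ← Real.exp_neg,
    Real.le_sqrt' (Real.exp_pos _), ← Real.exp_nat_mul]
  exact (exp_neg_sub_sq_le hz).trans_eq' (by congr 1; push_cast; ring)

variable {Ω ι : Type*} [MeasurableSpace Ω] {P : Measure Ω}

lemma mgf_sq_of_hasLaw {Y : Ω → ℝ} {v : ℝ≥0} (hY : HasLaw Y (gaussianReal 0 v) P) (hv : v ≠ 0)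
    {l : ℝ} (hl : 2 * l * v < 1) : mgf (fun ω => Y ω ^ 2) P l = (√(1 - 2 * l * v))⁻¹ := by
  rw [← integral_exp_mul_sq_gaussianReal hv hl, mgf]
  exact hY.integral_comp (f := fun y => Real.exp (l * y ^ 2)) (by fun_prop)

variable [Fintype ι] {Y : ι → Ω → ℝ} {v : ℝ≥0} (hY : ∀ i, HasLaw (Y i) (gaussianReal 0 v) P)
  (hind : iIndepFun Y P)
include hY hind

lemma mgf_sum_sq (hv : v ≠ 0) {z : ℝ} (hz : z < 1) :
    mgf (∑ i, fun ω => Y i ω ^ 2) P (z / (2 * v)) = (√(1 - z))⁻¹ ^ Fintype.card ι := by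
  have hv0 : (v : ℝ) ≠ 0 := NNReal.coe_ne_zero.2 hv
  have hl : 2 * (z / (2 * v)) * v = z := by field_simp
  have hsq : iIndepFun (fun i ω => Y i ω ^ 2) P := hind.comp (fun _ y => y ^ 2) (by fun_prop)
  rw [hsq.mgf_sum₀ fun i => (hY i).aemeasurable.pow_const 2]
  simp_rw [fun i => mgf_sq_of_hasLaw (hY i) hv (hl.trans_lt hz), hl]
  simp

lemma mgf_sum_sq_le (hv : v ≠ 0) {z : ℝ} (hz : |z| ≤ 1 / 2) :
    mgf (∑ i, fun ω => Y i ω ^ 2) P (z / (2 * v)) ≤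
      Real.exp (Fintype.card ι * (z / 2 + z ^ 2 / 2)) := by
  rw [mgf_sum_sq hY hind hv (by linarith [(abs_le.1 hz).2]), Real.exp_nat_mul]
  exact pow_le_pow_left₀ (by positivity) (inv_sqrt_one_sub_le hz) _

lemma integrable_exp_mul_sum_sq (hv : v ≠ 0) {z : ℝ} (hz : |z| ≤ 1 / 2) :
    Integrable (fun ω => Real.exp (z / (2 * v) * (∑ i, fun ω => Y i ω ^ 2) ω)) P := by
  have hz' : 0 < 1 - z := by linarith [(abs_le.1 hz).2]
  refine .of_integral_ne_zero ?_
  rw [← mgf, mgf_sum_sq hY hind hv (by linarith)]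
  have := Real.sqrt_pos.2 hz'
  positivity

variable [IsProbabilityMeasure P]

lemma measureReal_le_sum_sq_le (hv : v ≠ 0) {t : ℝ} (ht0 : 0 ≤ t) (ht1 : t ≤ 1) :
    P.real {ω | Fintype.card ι * v * (1 + t) ≤ (∑ i, fun ω => Y i ω ^ 2) ω} ≤
      Real.exp (-(Fintype.card ι * t ^ 2 / 8)) := by
  have hv0 : (v : ℝ) ≠ 0 := NNReal.coe_ne_zero.2 hv
  have hz : |t / 2| ≤ 1 / 2 := abs_le.2 ⟨by linarith, by linarith⟩
  refine (measure_ge_le_exp_mul_mgf _ (t := t / 2 / (2 * v)) (by positivity)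
    (integrable_exp_mul_sum_sq hY hind hv hz)).trans ?_
  refine (mul_le_mul_of_nonneg_left (mgf_sum_sq_le hY hind hv hz) (Real.exp_nonneg _)).trans_eq ?_
  rw [← Real.exp_add]
  congr 1
  field_simp
  ring

lemma measureReal_sum_sq_le_le (hv : v ≠ 0) {t : ℝ} (ht0 : 0 ≤ t) (ht1 : t ≤ 1) :
    P.real {ω | (∑ i, fun ω => Y i ω ^ 2) ω ≤ Fintype.card ι * v * (1 - t)} ≤
      Real.exp (-(Fintype.card ι * t ^ 2 / 8)) := by
  have hv0 : (v : ℝ) ≠ 0 := NNReal.coe_ne_zero.2 hv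
  have hz : |-(t / 2)| ≤ 1 / 2 := abs_le.2 ⟨by linarith, by linarith⟩
  refine (measure_le_le_exp_mul_mgf _ (t := -(t / 2) / (2 * v))
    (div_nonpos_of_nonpos_of_nonneg (by linarith) (by positivity))
    (integrable_exp_mul_sum_sq hY hind hv hz)).trans ?_
  refine (mul_le_mul_of_nonneg_left (mgf_sum_sq_le hY hind hv hz) (Real.exp_nonneg _)).trans_eq ?_
  rw [← Real.exp_add]
  congr 1
  field_simp
  ring

lemma measureReal_lt_abs_mean_sq_sub_le [Nonempty ι] {t : ℝ} (ht0 : 0 ≤ t) (ht1 : t ≤ 1) :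
    P.real {ω | t * v < |(∑ i, Y i ω ^ 2) / Fintype.card ι - v|} ≤
      2 * Real.exp (-(Fintype.card ι * t ^ 2 / 8)) := by
  have hn : (0 : ℝ) < Fintype.card ι := Nat.cast_pos.2 Fintype.card_pos
  rcases eq_or_ne v 0 with rfl | hv
  · have degenerate : ∀ᵐ ω ∂P, ∀ i, Y i ω = 0 := ae_all_iff.2 fun i =>
      HasLaw.ae_eq_of_dirac (by simpa using hY i)
    have null : P.real {ω | t * ((0 : ℝ≥0) : ℝ) <
        |(∑ i, Y i ω ^ 2) / Fintype.card ι - ((0 : ℝ≥0) : ℝ)|} = 0 := by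
      rw [measureReal_eq_zero_iff, measure_eq_zero_iff_ae_notMem]
      filter_upwards [degenerate] with ω hω
      simp [hω]
    rw [null]
    positivity
  have subset : {ω | t * v < |(∑ i, Y i ω ^ 2) / Fintype.card ι - v|} ⊆
      {ω | Fintype.card ι * v * (1 + t) ≤ (∑ i, fun ω => Y i ω ^ 2) ω} ∪
        {ω | (∑ i, fun ω => Y i ω ^ 2) ω ≤ Fintype.card ι * v * (1 - t)} := by
    intro ω hω
    simp only [Set.mem_ofPred_eq, Set.mem_union, Finset.sum_apply] at hω ⊢
    rcases lt_abs.1 hω with h | h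
    · have large := (lt_div_iff₀' hn).1 (lt_sub_iff_add_lt.1 h)
      exact Or.inl (large.le.trans_eq' (by ring))
    · rw [neg_sub] at h
      have small := (div_lt_iff₀' hn).1 (lt_sub_comm.1 h)
      exact Or.inr (small.le.trans_eq (by ring))
  calc _ ≤ _ := measureReal_mono subset
    _ ≤ _ := measureReal_union_le _ _
    _ ≤ _ := add_le_add (measureReal_le_sum_sq_le hY hind hv ht0 ht1)
      (measureReal_sum_sq_le_le hY hind hv ht0 ht1)
    _ = _ := by ring

end ChiSquare

section SampleCovariance

variable {p n : ℕ} (x : Fin n → Vec p)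

lemma isSymm_sampleCov : (sampleCov x).IsSymm := by
  ext i j
  simp only [Matrix.transpose_apply, sampleCov, Matrix.of_apply, mul_comm]

lemma form_sampleCov (v : Vec p) :
    form (sampleCov x) v v = (∑ i, inner ℝ v (x i) ^ 2) / n := by
  have square (i : Fin n) : inner ℝ v (x i) ^ 2 = ∑ j, ∑ k, v j * (x i j * x i k) * v k := by
    simp only [sq, PiLp.inner_apply, Finset.sum_mul_sum, RCLike.inner_apply, conj_trivial]
    exact Finset.sum_congr rfl fun j _ => Finset.sum_congr rfl fun k _ => by ring
  simp only [form_apply, sampleCov, Matrix.of_apply, square, mul_div_assoc', div_mul_eq_mul_div,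
    Finset.mul_sum, Finset.sum_mul, ← Finset.sum_div]
  congr 1
  exact (Finset.sum_comm.trans (Finset.sum_congr rfl fun _ _ => Finset.sum_comm)).symm

/-- The empirical quadratic form approximates that of `S`, up to a relative error of order
`√(s ln p / n)`, on the net of `2 s`-sparse vectors. -/
def IsConcentrated (S : Matrix (Fin p) (Fin p) ℝ) (s : ℕ) : Prop :=
  ∀ v ∈ net p (2 * (2 * s)) (2 * s),
    |form (sampleCov x) v v - form S v v| ≤ 11 * √(rate s p n) * form S v v

variable {Ω : Type*} [MeasurableSpace Ω] {P : Measure Ω} {S : Matrix (Fin p) (Fin p) ℝ}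
  (hS : S.PosSemidef)
include hS

lemma map_inner_multivariateGaussian (v : Vec p) :
    (multivariateGaussian 0 S).map (innerSL ℝ v) = gaussianReal 0 (form S v v).toNNReal := by
  have variance : Var[innerSL ℝ v; multivariateGaussian 0 S] = form S v v := by
    rw [form_eq_dotProduct, ← covarianceBilin_multivariateGaussian hS,
      covarianceBilin_self IsGaussian.memLp_two_id]
    rfl
  rw [IsGaussian.map_eq_gaussianReal, ContinuousLinearMap.integral_comp_id_comm
    IsGaussian.integrable_id, integral_id_multivariateGaussian, map_zero, variance]

lemma hasLaw_inner {X : Ω → Vec p} (hX : HasLaw X (multivariateGaussian 0 S) P) (v : Vec p) :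
    HasLaw (fun ω => inner ℝ v (X ω)) (gaussianReal 0 (form S v v).toNNReal) P := by
  have hinner : HasLaw (innerSL ℝ v) (gaussianReal 0 (form S v v).toNNReal)
      (multivariateGaussian 0 S) := ⟨by fun_prop, map_inner_multivariateGaussian hS v⟩
  exact hinner.comp hX

variable [IsProbabilityMeasure P] {X : Fin n → Ω → Vec p}
  (hX : ∀ i, HasLaw (X i) (multivariateGaussian 0 S) P) (hind : iIndepFun X P)
include hX hind

lemma measureReal_lt_abs_form_sampleCov_sub_le (hn : 0 < n) {t : ℝ} (ht0 : 0 ≤ t) (ht1 : t ≤ 1)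
    (v : Vec p) :
    P.real {ω | t * form S v v < |form (sampleCov fun i => X i ω) v v - form S v v|} ≤
      2 * Real.exp (-(n * t ^ 2 / 8)) := by
  have : Nonempty (Fin n) := Fin.pos_iff_nonempty.1 hn
  have hlaw (i : Fin n) := hasLaw_inner hS (hX i) v
  have hinner : iIndepFun (fun i ω => inner ℝ v (X i ω)) P :=
    hind.comp (fun _ y => inner ℝ v y) (by fun_prop)
  have hv : 0 ≤ form S v v := (isPosSemidef_form hS).nonneg v
  simpa only [Real.coe_toNNReal _ hv, Fintype.card_fin, form_sampleCov] using
    measureReal_lt_abs_mean_sq_sub_le hlaw hinner ht0 ht1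

lemma measureReal_exists_lt_abs_form_sampleCov_sub_le (hn : 0 < n) {t : ℝ} (ht0 : 0 ≤ t)
    (ht1 : t ≤ 1) (F : Finset (Vec p)) :
    P.real {ω | ∃ v ∈ F, t * form S v v < |form (sampleCov fun i => X i ω) v v - form S v v|} ≤
      F.card * (2 * Real.exp (-(n * t ^ 2 / 8))) := by
  have union : {ω | ∃ v ∈ F, t * form S v v <
      |form (sampleCov fun i => X i ω) v v - form S v v|} =
      ⋃ v ∈ F, {ω | t * form S v v < |form (sampleCov fun i => X i ω) v v - form S v v|} := by
    ext ω
    simp only [Set.mem_ofPred_eq, Set.mem_iUnion, exists_prop]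
  rw [union, ← nsmul_eq_mul]
  exact (measureReal_biUnion_finset_le _ _).trans (Finset.sum_le_card_nsmul _ _ _ fun v _ =>
    measureReal_lt_abs_form_sampleCov_sub_le hS hX hind hn ht0 ht1 v)

lemma measureReal_not_isConcentrated_le (hn : 0 < n) {s : ℕ} (hs : 0 < s) (hsp : s ≤ p)
    (hp : 2 ≤ p) (hrate : 11 * √(rate s p n) ≤ 1) :
    P.real {ω | ¬IsConcentrated (fun i => X i ω) S s} ≤ 2 / p := by
  simp only [IsConcentrated, not_forall, not_le, exists_prop]
  have exponent : n * (11 * √(rate s p n)) ^ 2 = 121 * (s * Real.log p) := by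
    rw [mul_pow, Real.sq_sqrt (by unfold rate; positivity), rate]
    field_simp
    ring
  have log_le : 1 * Real.log p ≤ s * Real.log p := by gcongr; exact mod_cast hs
  calc _ ≤ (net p (2 * (2 * s)) (2 * s)).card *
        (2 * Real.exp (-(n * (11 * √(rate s p n)) ^ 2 / 8))) :=
        measureReal_exists_lt_abs_form_sampleCov_sub_le hS hX hind hn (by positivity) hrate _
    _ ≤ Real.exp (12 * (s * Real.log p)) * (2 * Real.exp (-(121 * (s * Real.log p) / 8))) := by
      rw [exponent]
      gcongr
      exact card_net_le_exp hsp hp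
    _ = 2 * Real.exp (12 * (s * Real.log p) + -(121 * (s * Real.log p) / 8)) := by
      rw [Real.exp_add]
      ring
    _ ≤ 2 * Real.exp (-Real.log p) := by
      gcongr
      linarith [Real.log_natCast_nonneg p]
    _ = 2 / p := by rw [Real.exp_neg, Real.exp_log (by positivity), div_eq_mul_inv]

end SampleCovariance

section Signs

variable {E : Type*} [NormedAddCommGroup E] [InnerProductSpace ℝ E] {x b : E}

lemma sq_norm_sub_eq (hb : ‖b‖ = 1) (hx : ‖x‖ = 1) : ‖b - x‖ ^ 2 = 2 * (1 - inner ℝ b x) := by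
  rw [norm_sub_sq_real, hb, hx]
  ring

lemma exists_sign (hb : ‖b‖ = 1) (hx : ‖x‖ = 1) :
    ∃ z, (z = x ∨ z = -x) ∧ ‖b - z‖ ^ 2 = 2 * (1 - |inner ℝ b x|) := by
  rcases le_total 0 (inner ℝ b x) with h | h
  · exact ⟨x, .inl rfl, by rw [sq_norm_sub_eq hb hx, abs_of_nonneg h]⟩
  · exact ⟨-x, .inr rfl, by
      rw [sq_norm_sub_eq hb ((norm_neg x).trans hx), inner_neg_right, abs_of_nonpos h]⟩

end Signs

lemma exists_last_le {y : ℕ → ℝ} {θ : ℝ} (h₀ : θ ≤ y 0) (h : ∃ t, y t < θ) :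
    ∃ T, (∀ i ≤ T, θ ≤ y i) ∧ y (T + 1) < θ := by
  classical
  obtain ⟨T, hT⟩ := Nat.exists_eq_succ_of_ne_zero
    (n := Nat.find h) fun h0 => h₀.not_gt (h0 ▸ Nat.find_spec h)
  exact ⟨T, fun i hi => not_lt.1 (Nat.find_min h (by omega)), by simpa [hT] using Nat.find_spec h⟩

section PerturbedRun

variable {p : ℕ}

/-- Ascent iterates `b t` with `ℓ₁` bounds `ℓ t` for a pair of forms `S'`, `L'` within the
statistical error `e` of a pair with leading direction `x`. The slack of the bounds, in units of
`√‖x‖₀`, starts above `B`, drops by at most `μ * e` per iteration, and vanishes in the limit. -/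
structure IsPerturbedRun (S L S' L' : LinearMap.BilinForm ℝ (Vec p)) (x : Vec p)
    (M γ η A B μ e : ℝ) (ℓ : ℕ → ℝ) (b : ℕ → Vec p) : Prop where
  isLeading : IsLeading S L x M γ
  isClose_left : IsClose (mixedNorm (l0 x)) e S S'
  isClose_right : IsClose (mixedNorm (l0 x)) e L L'
  error_pos : 0 < e
  isAscentRun : IsAscentRun S' L' η ℓ b
  bound_le (t : ℕ) : ℓ t ≤ A * √(l0 x : ℝ)
  le_bound_zero : l1 x + B * √(l0 x : ℝ) ≤ ℓ 0
  bound_le_succ (t : ℕ) : ℓ t ≤ ℓ (t + 1) + μ * e * √(l0 x : ℝ)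
  exists_limit : ∃ l ≤ l1 x, Tendsto ℓ atTop (𝓝 l)

variable {S L S' L' : LinearMap.BilinForm ℝ (Vec p)} {x : Vec p} {M γ η A B μ e θ : ℝ} {ℓ : ℕ → ℝ}
  {b : ℕ → Vec p}

namespace IsPerturbedRun

variable (h : IsPerturbedRun S L S' L' x M γ η A B μ e ℓ b)
include h

protected lemma neg : IsPerturbedRun S L S' L' (-x) M γ η A B μ e ℓ b where
  __ := h
  isLeading := h.isLeading.neg
  isClose_left := by simpa using h.isClose_left
  isClose_right := by simpa using h.isClose_right
  bound_le := by simpa using h.bound_le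
  le_bound_zero := by simpa using h.le_bound_zero
  bound_le_succ := by simpa using h.bound_le_succ
  exists_limit := by simpa using h.exists_limit

lemma of_eq_or_eq_neg {z : Vec p} (hz : z = x ∨ z = -x) :
    IsPerturbedRun S L S' L' z M γ η A B μ e ℓ b := by
  rcases hz with rfl | rfl
  exacts [h, h.neg]

lemma mem_feasible (t : ℕ) : b t ∈ feasible p (A * √(l0 x : ℝ)) :=
  ⟨(h.isAscentRun t).1.1, (h.isAscentRun t).1.2.trans (h.bound_le t)⟩

lemma slack_le_succ (t : ℕ) : (ℓ t - l1 x) / √(l0 x : ℝ) ≤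
    (ℓ (t + 1) - l1 x) / √(l0 x : ℝ) + μ * e := by
  have hs := sqrt_l0_pos h.isLeading.norm_eq
  rw [div_add' _ _ _ hs.ne']
  gcongr
  linarith [h.bound_le_succ t]

lemma le_slack_zero : B ≤ (ℓ 0 - l1 x) / √(l0 x : ℝ) := by
  rw [le_div_iff₀ (sqrt_l0_pos h.isLeading.norm_eq)]
  linarith [h.le_bound_zero]

lemma exists_last_le_slack (hθ : 0 < θ) (hθB : θ ≤ B) : ∃ T,
    (∀ i ≤ T, θ ≤ (ℓ i - l1 x) / √(l0 x : ℝ)) ∧ (ℓ T - l1 x) / √(l0 x : ℝ) ≤ θ + μ * e := by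
  have hs := sqrt_l0_pos h.isLeading.norm_eq
  obtain ⟨l, hl, hlim⟩ := h.exists_limit
  have hslack : Tendsto (fun t => (ℓ t - l1 x) / √(l0 x : ℝ)) atTop
      (𝓝 ((l - l1 x) / √(l0 x : ℝ))) := (hlim.sub_const _).div_const _
  obtain ⟨T, hT, hT1⟩ := exists_last_le (hθB.trans h.le_slack_zero)
    (hslack.eventually_lt_const
      ((div_nonpos_of_nonpos_of_nonneg (by linarith) hs.le).trans_lt hθ)).exists
  exact ⟨T, hT, by linarith [h.slack_le_succ T]⟩

end IsPerturbedRun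

lemma exists_close_iterate_constants {M γ η A : ℝ} (hM : 0 < M) (hγ : 0 < γ) (hη : 0 < η)
    (hηM : η * M ≤ 1) (hA : 1 ≤ A) :
    ∃ c : ℝ, 0 < c ∧ ∀ B μ K₀ : ℝ, 0 < B → 0 ≤ μ → ∃ a e₀ : ℝ, 0 ≤ a ∧ 0 < e₀ ∧
      ∀ {p : ℕ} {S L S' L' : LinearMap.BilinForm ℝ (Vec p)} {x : Vec p} {e : ℝ} {ℓ : ℕ → ℝ}
        {b : ℕ → Vec p}, IsPerturbedRun S L S' L' x M γ η A B μ e ℓ b → e ≤ e₀ →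
        ‖b 0 - x‖ ^ 2 ≤ c * B ^ 2 →
        ∃ T, K₀ * e * √(l0 x : ℝ) ≤ ℓ T - l1 x ∧ ‖b T - x‖ ≤ a * e ∧
          (l1 (b T) - l1 x) / √(l0 x : ℝ) ≤ a * e := by
  -- A smaller gap is assumed so that the contraction factor of the ascent is at most one.
  obtain ⟨γ', hγ', hγ'γ, hκ⟩ : ∃ γ', 0 < γ' ∧ γ' ≤ γ ∧ η * γ' / (2 * M) ≤ 1 := by
    refine ⟨min γ (2 * M / η), by positivity, min_le_left _ _, ?_⟩
    rw [div_le_one (by positivity), ← le_div_iff₀' hη]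
    exact min_le_right _ _
  obtain ⟨c, hc, hrun⟩ := exists_run_constants hM hγ' hη hηM hκ hA
  refine ⟨c, hc, fun B μ K₀ hB hμ => ?_⟩
  obtain ⟨K₁, e₀, hK₀, hK₁, he₀, hrun⟩ := hrun μ K₀
  refine ⟨(√c + 1) * (K₁ + μ), min e₀ (B / K₁), by positivity, by positivity, ?_⟩
  intro p S L S' L' x e ℓ b h he h0
  have he_pos := h.error_pos
  have hs := sqrt_l0_pos h.isLeading.norm_eq
  obtain ⟨T, hlarge, hsmall⟩ := h.exists_last_le_slack (mul_pos hK₁ he_pos)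
    ((le_div_iff₀' hK₁).1 (he.trans (min_le_right _ _)))
  have hT := hlarge T le_rfl
  have hT0 : 0 ≤ (ℓ T - l1 x) / √(l0 x : ℝ) := hT.trans' (by positivity)
  rw [← add_mul] at hsmall
  have hbT : ‖b T - x‖ ^ 2 ≤ c * ((ℓ T - l1 x) / √(l0 x : ℝ)) ^ 2 :=
    hrun (h.isLeading.mono_gap hγ' hγ'γ) h.isClose_left h.isClose_right he_pos
      (he.trans (min_le_left _ _)) h.isAscentRun h.bound_le (fun _ => rfl) h.slack_le_succ
      (h0.trans (by gcongr; exact h.le_slack_zero)) T hlarge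
  refine ⟨T, ?_, ?_, ?_⟩
  · rw [← le_div_iff₀ hs]
    exact hT.trans' (by gcongr)
  · refine le_of_sq_le_sq (hbT.trans ?_) (by positivity)
    calc c * ((ℓ T - l1 x) / √(l0 x : ℝ)) ^ 2 ≤ √c ^ 2 * ((K₁ + μ) * e) ^ 2 := by
          rw [Real.sq_sqrt hc.le]; gcongr
      _ ≤ (√c + 1) ^ 2 * ((K₁ + μ) * e) ^ 2 := by gcongr; linarith
      _ = _ := by ring
  · calc (l1 (b T) - l1 x) / √(l0 x : ℝ) ≤ (ℓ T - l1 x) / √(l0 x : ℝ) := by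
          gcongr; exact (h.isAscentRun T).1.2
      _ ≤ 1 * ((K₁ + μ) * e) := by rwa [one_mul]
      _ ≤ _ := by rw [mul_assoc]; gcongr; linarith [Real.sqrt_nonneg c]

lemma penalizedRayleigh_of_eq_or_eq_neg (S L : LinearMap.BilinForm ℝ (Vec p)) (τ c₂ A : ℝ) (s : ℕ)
    {u v : Vec p} (h : u = v ∨ u = -v) :
    penalizedRayleigh S L τ c₂ A s u = penalizedRayleigh S L τ c₂ A s v := by
  rcases h with rfl | rfl <;> simp [penalizedRayleigh]

/-- The constant in the optimal rate of the selected iterate. -/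
def selectionConst (M γ A a c₂ τ : ℝ) : ℝ :=
  (3 * recenteringConst M A + τ * (1 + 2 * c₂)) ^ 2 / (γ / (4 * M ^ 2)) ^ 2 +
    2 * (4 * recenteringConst M A * a + 2 * M ^ 2 * a ^ 2 + τ * a * (1 + 2 * c₂)) /
      (γ / (4 * M ^ 2))

lemma IsPerturbedRun.discrepancy_le_of_penalized {a c₂ τ : ℝ} {w : Vec p}
    (h : IsPerturbedRun S L S' L' x M γ η A B μ e ℓ b) (hA : 1 ≤ A)
    (hsmall : 4 * (1 + A) ^ 2 * e ≤ 1 / (2 * M)) (hc₂ : 0 < c₂) (ha : 0 ≤ a)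
    (hτ : recenteringConst M A ≤ τ) (hw : w ∈ feasible p (A * √(l0 x : ℝ)))
    (hwx : ‖w - x‖ ≤ a * e) (hwl : (l1 w - l1 x) / √(l0 x : ℝ) ≤ a * e) {t : ℕ}
    (hcomp : penalizedRayleigh S' L' (τ * e) c₂ A (l0 x) w ≤
      penalizedRayleigh S' L' (τ * e) c₂ A (l0 x) (b t)) :
    discrepancy x (b t) ≤ selectionConst M γ A a c₂ τ / 2 * e ^ 2 := by
  obtain ⟨u, hu, hux⟩ := exists_sign h.isLeading.norm_eq (h.mem_feasible t).1
  rw [real_inner_comm, norm_sub_rev, ← discrepancy] at hux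
  have hmem : u ∈ feasible p (A * √(l0 x : ℝ)) := by
    rcases hu with rfl | rfl
    · exact h.mem_feasible t
    · simpa [feasible] using h.mem_feasible t
  rw [← penalizedRayleigh_of_eq_or_eq_neg _ _ _ _ _ _ hu] at hcomp
  have hux2 : ‖u - x‖ ^ 2 ≤ 2 := by
    rw [hux, discrepancy]
    linarith [abs_nonneg (inner ℝ (b t) x)]
  have := h.isLeading.sq_norm_sub_le_of_penalized h.isClose_left h.isClose_right h.error_pos.le hA
    hsmall hc₂ ha hτ hmem hw hux2 hwx hwl hcomp
  rw [hux, ← selectionConst] at this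
  linarith

lemma exists_selection_constants {M γ η A : ℝ} (hM : 0 < M) (hγ : 0 < γ) (hη : 0 < η)
    (hηM : η * M ≤ 1) (hA : 1 ≤ A) :
    ∃ c : ℝ, 0 < c ∧ ∀ B μ K₀ c₂ τ : ℝ, 0 < B → 0 ≤ μ → 0 < c₂ → recenteringConst M A ≤ τ →
      ∃ κ e₀ : ℝ, 0 < κ ∧ 0 < e₀ ∧
      ∀ {p : ℕ} {S L S' L' : LinearMap.BilinForm ℝ (Vec p)} {x : Vec p} {e : ℝ} {ℓ : ℕ → ℝ}
        {b : ℕ → Vec p}, IsPerturbedRun S L S' L' x M γ η A B μ e ℓ b → e ≤ e₀ →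
        discrepancy x (b 0) ≤ c * B ^ 2 →
        ∃ T, K₀ * e * √(l0 x : ℝ) ≤ ℓ T - l1 x ∧ ∀ t,
          penalizedRayleigh S' L' (τ * e) c₂ A (l0 x) (b T) ≤
            penalizedRayleigh S' L' (τ * e) c₂ A (l0 x) (b t) →
          discrepancy x (b t) ≤ κ * e ^ 2 := by
  obtain ⟨c, hc, hclose⟩ := exists_close_iterate_constants hM hγ hη hηM hA
  refine ⟨c / 2, by positivity, fun B μ K₀ c₂ τ hB hμ hc₂ hτ => ?_⟩
  obtain ⟨a, e₀, ha, he₀, hclose⟩ := hclose B μ K₀ hB hμ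
  have hC : 0 < recenteringConst M A := by unfold recenteringConst; positivity
  have hτ0 : 0 < τ := hC.trans_le hτ
  refine ⟨selectionConst M γ A a c₂ τ / 2, min e₀ (1 / (2 * M) / (4 * (1 + A) ^ 2)),
    by unfold selectionConst; positivity, by positivity, ?_⟩
  intro p S L S' L' x e ℓ b h he h0
  obtain ⟨z, hz, hbz⟩ := exists_sign (h.mem_feasible 0).1 h.isLeading.norm_eq
  have hl0 : l0 z = l0 x := by rcases hz with rfl | rfl <;> simp
  have hl1 : l1 z = l1 x := by rcases hz with rfl | rfl <;> simp
  have hdisc (u : Vec p) : discrepancy z u = discrepancy x u := by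
    rcases hz with rfl | rfl <;> simp [discrepancy]
  have hrun := h.of_eq_or_eq_neg hz
  obtain ⟨T, hT, hbT, hbTl⟩ := hclose hrun (he.trans (min_le_left _ _))
    (by rw [hbz, ← discrepancy]; linarith)
  rw [← hl0, ← hl1]
  refine ⟨T, hT, fun t ht => ?_⟩
  rw [← hdisc]
  exact hrun.discrepancy_le_of_penalized hA
    ((le_div_iff₀' (by positivity)).1 (he.trans (min_le_right _ _))) hc₂ ha hτ
    (hrun.mem_feasible T) hbT hbTl ht

end PerturbedRun

lemma sqrt_rate_eq (s p n : ℕ) : √(rate s p n) = √(s : ℝ) * √(Real.log p / n) := by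
  rw [rate, mul_div_assoc, Real.sqrt_mul (Nat.cast_nonneg _)]

lemma sqrt_sq_mul_eq (s p n : ℕ) :
    √((s : ℝ) ^ 2 * Real.log p / n) = √(rate s p n) * √(s : ℝ) := by
  rw [← Real.sqrt_mul' _ (Nat.cast_nonneg _), rate]
  congr 1
  ring

lemma rate_pos {s p n : ℕ} (hs : 0 < s) (hp : 2 ≤ p) (hn : 0 < n) : 0 < rate s p n := by
  have := Real.log_pos (show (1 : ℝ) < p by exact_mod_cast hp)
  unfold rate
  positivity

section Bounds

variable {cB₁ cB₂ η Linf : ℝ} {s p n : ℕ}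

@[simp] lemma bound_zero : bound cB₁ cB₂ η Linf s p n 0 = initBound cB₁ s := by simp [bound]

lemma bound_le (h0 : 0 ≤ cB₂ * η * √(rate s p n)) (h1 : cB₂ * η * √(rate s p n) ≤ 1)
    (hL : Linf ≤ initBound cB₁ s) (t : ℕ) : bound cB₁ cB₂ η Linf s p n t ≤ initBound cB₁ s := by
  have hpow : (1 - cB₂ * η * √(rate s p n)) ^ t ≤ 1 := pow_le_one₀ (by linarith) (by linarith)
  have := mul_le_mul_of_nonneg_right hpow (sub_nonneg.2 hL)
  rw [bound]
  linarith

lemma bound_le_succ_add (h0 : 0 ≤ cB₂ * η * √(rate s p n)) (h1 : cB₂ * η * √(rate s p n) ≤ 1)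
    (hL0 : 0 ≤ Linf) (hL : Linf ≤ initBound cB₁ s) (t : ℕ) :
    bound cB₁ cB₂ η Linf s p n t ≤
      bound cB₁ cB₂ η Linf s p n (t + 1) + cB₂ * η * √(rate s p n) * initBound cB₁ s := by
  have hexcess : bound cB₁ cB₂ η Linf s p n t - Linf ≤ initBound cB₁ s :=
    (sub_le_self _ hL0).trans (bound_le h0 h1 hL t)
  have hstep : bound cB₁ cB₂ η Linf s p n t - bound cB₁ cB₂ η Linf s p n (t + 1) =
      cB₂ * η * √(rate s p n) * (bound cB₁ cB₂ η Linf s p n t - Linf) := by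
    rw [bound, bound]
    ring
  linarith [mul_le_mul_of_nonneg_left hexcess h0]

lemma tendsto_bound (h0 : 0 < cB₂ * η * √(rate s p n)) (h1 : cB₂ * η * √(rate s p n) ≤ 1) :
    Tendsto (bound cB₁ cB₂ η Linf s p n) atTop (𝓝 Linf) := by
  have hpow : Tendsto (fun t : ℕ => (1 - cB₂ * η * √(rate s p n)) ^ t) atTop (𝓝 0) :=
    tendsto_pow_atTop_nhds_zero_of_lt_one (by linarith) (by linarith)
  have hlim := (hpow.mul_const (initBound cB₁ s - Linf)).const_add Linf
  rwa [zero_mul, add_zero] at hlim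

lemma le_lastIter {M γ c₀ ℓ : ℝ} (h0 : 0 < cB₂ * η * √(rate s p n))
    (h1 : cB₂ * η * √(rate s p n) ≤ 1) (hL : Linf ≤ ℓ) {t : ℕ}
    (hpos : 0 < 4 * cB₂ * (1 + cB₁) / ((1 - c₀) * γ ^ 2 / M) * √((s : ℝ) ^ 2 * Real.log p / n))
    (ht : 4 * cB₂ * (1 + cB₁) / ((1 - c₀) * γ ^ 2 / M) * √((s : ℝ) ^ 2 * Real.log p / n) ≤
      bound cB₁ cB₂ η Linf s p n t - ℓ) :
    t ≤ lastIter M γ c₀ cB₁ cB₂ η Linf ℓ s p n := by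
  have hsmall := (tendsto_bound (cB₁ := cB₁) h0 h1).eventually_lt_const
    (show Linf < 4 * cB₂ * (1 + cB₁) / ((1 - c₀) * γ ^ 2 / M) *
      √((s : ℝ) ^ 2 * Real.log p / n) + ℓ by linarith)
  obtain ⟨N, hN⟩ := eventually_atTop.1 hsmall
  refine le_csSup ⟨N, fun i hi => ?_⟩ ht
  by_contra! hNi
  exact (hN i hNi.le).not_ge (le_sub_iff_add_le.1 hi)

end Bounds

section Sample

variable {p D n : ℕ} {blk : Fin p → Fin D} {x : Fin n → Vec p}

lemma objective_eq_div (blk : Fin p → Fin D) (x : Fin n → Vec p) (b : Vec p) : objective blk x b =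
    form (sampleCov x) b b / form (blockPart blk (sampleCov x)) b b := by
  rw [objective, rayleigh, quad_eq_form, quad_eq_form]

lemma inner_proxTarget (blk : Fin p → Fin D) (x : Fin n → Vec p) (η : ℝ) (b v : Vec p) :
    inner ℝ v (proxTarget blk x η b) =
      ascent (form (sampleCov x)) (form (blockPart blk (sampleCov x))) η b v := by
  have inner_mulVec (A : Matrix (Fin p) (Fin p) ℝ) :
      inner ℝ v (WithLp.toLp 2 (A.mulVec b.ofLp)) = form A v b := by
    rw [form_eq_dotProduct, EuclideanSpace.inner_eq_star_dotProduct, star_trivial, dotProduct_comm]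
  rw [proxTarget, inner_add_right, inner_smul_right, inner_mulVec, map_sub, map_smul,
    objective_eq_div, ascent_apply]
  rfl

lemma IsRun.isAscentRun {η : ℝ} {ℓ : ℕ → ℝ} {b : ℕ → Vec p} (h : IsRun blk x η ℓ b)
    (h0 : b 0 ∈ feasible p (ℓ 0)) :
    IsAscentRun (form (sampleCov x)) (form (blockPart blk (sampleCov x))) η ℓ b := by
  refine fun t => ⟨?_, fun v hv => ?_⟩
  · cases t with
    | zero => exact h0
    | succ t => exact (h t).1
  · have := (h t).2 v hv
    rw [norm_sub_sq_real, norm_sub_sq_real, (h t).1.1, hv.1, inner_proxTarget,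
      inner_proxTarget] at this
    linarith

lemma penalized_eq {cB₁ ρ : ℝ} {s : ℕ} (hs : 0 < √(s : ℝ)) (hρ : ρ ≠ 0) (τ c₂ : ℝ)
    (u : Vec p) : penalized blk x τ ρ c₂ (initBound cB₁ s) u =
      ρ * penalizedRayleigh (ρ⁻¹ • form (sampleCov x)) (form (blockPart blk (sampleCov x)))
        (τ * √(rate s p n)) c₂ (1 + cB₁) s u := by
  rw [penalized, objective_eq_div, penalizedRayleigh, penalty, initBound, sqrt_rate_eq,
    LinearMap.smul_apply, LinearMap.smul_apply, smul_eq_mul]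
  field_simp

namespace IsPopulation

variable {S : Matrix (Fin p) (Fin p) ℝ} {ξ : ℕ → Vec p} {M γ C : ℝ}
  (h : IsPopulation blk S ξ M γ C) (hM : 0 < M) (hγ : 0 < γ) (hp : 2 ≤ p)
include h hM hγ hp

lemma l0_pos : 0 < l0 (ξ 1) :=
  MsCCA.l0_pos (norm_ne_zero_iff.1 ((h.isLeading hM hγ hp).norm_eq ▸ one_ne_zero))

lemma l1_le_sqrt : l1 (ξ 1) ≤ √(l0 (ξ 1) : ℝ) := by
  simpa [(h.isLeading hM hγ hp).norm_eq] using l1_le_sqrt_l0 (ξ 1)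

lemma isClose (hx : IsConcentrated x S (l0 (ξ 1))) :
    IsClose (mixedNorm (l0 (ξ 1))) (44 * M * √(rate (l0 (ξ 1)) p n))
      ((corr blk S ξ 1)⁻¹ • form S) ((corr blk S ξ 1)⁻¹ • form (sampleCov x)) := by
  have hρ : 0 < corr blk S ξ 1 := one_pos.trans_le (h.one_le_corr (by omega))
  have upper (u : Vec p) : form S u u ≤ corr blk S ξ 1 * M * ‖u‖ ^ 2 := by
    rw [mul_assoc]
    exact (h.form_le_corr_mul hM (by omega) u).trans (by gcongr; exact h.form_le u)
  convert (isClose_of_net h.isSymm (isSymm_sampleCov x) (h.l0_pos hM hγ hp) (by omega)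
    (by positivity) (by positivity) hx upper).smul (corr blk S ξ 1)⁻¹ using 1
  rw [abs_of_pos (inv_pos.2 hρ)]
  field_simp
  ring

lemma isClose_blockPart (hx : IsConcentrated x S (l0 (ξ 1))) :
    IsClose (mixedNorm (l0 (ξ 1))) (44 * M * √(rate (l0 (ξ 1)) p n))
      (form (blockPart blk S)) (form (blockPart blk (sampleCov x))) := by
  convert isClose_blockPart_of_net h.isSymm (isSymm_sampleCov x) (h.l0_pos hM hγ hp) (by omega)
    (by positivity) hM.le hx h.form_le using 1
  ring

lemma isPerturbedRun {η cB₁ cB₂ Linf : ℝ} {b : ℕ → Vec p} (hn : 0 < n) (hη : 0 < η)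
    (hcB₁ : 0 < cB₁) (hcB₂ : 0 < cB₂) (hrate : cB₂ * η * √(rate (l0 (ξ 1)) p n) ≤ 1)
    (hLinf0 : 0 ≤ Linf) (hLinf : Linf ≤ l1 (ξ 1)) (hx : IsConcentrated x S (l0 (ξ 1)))
    (hrun : IsRun blk x η (bound cB₁ cB₂ η Linf (l0 (ξ 1)) p n) b)
    (hb : b 0 ∈ feasible p (initBound cB₁ (l0 (ξ 1)))) :
    IsPerturbedRun ((corr blk S ξ 1)⁻¹ • form S) (form (blockPart blk S))
      ((corr blk S ξ 1)⁻¹ • form (sampleCov x)) (form (blockPart blk (sampleCov x))) (ξ 1) M γ η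
      (1 + cB₁) cB₁ (cB₂ * η * (1 + cB₁) / (44 * M)) (44 * M * √(rate (l0 (ξ 1)) p n))
      (bound cB₁ cB₂ η Linf (l0 (ξ 1)) p n) b := by
  have hρ : 0 < corr blk S ξ 1 := one_pos.trans_le (h.one_le_corr (by omega))
  have hε : 0 < √(rate (l0 (ξ 1)) p n) := Real.sqrt_pos.2 (rate_pos (h.l0_pos hM hγ hp) hp hn)
  have hl1 := h.l1_le_sqrt hM hγ hp
  have hdecay : 0 < cB₂ * η * √(rate (l0 (ξ 1)) p n) := by positivity
  have hLinit : Linf ≤ initBound cB₁ (l0 (ξ 1)) := by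
    rw [initBound]
    linarith [mul_nonneg hcB₁.le (Real.sqrt_nonneg (l0 (ξ 1)))]
  exact {
    isLeading := h.isLeading hM hγ hp
    isClose_left := h.isClose hM hγ hp hx
    isClose_right := h.isClose_blockPart hM hγ hp hx
    error_pos := by positivity
    isAscentRun := by
      rw [IsAscentRun, ascent_smul _ _ _ (inv_ne_zero hρ.ne')]
      exact hrun.isAscentRun (by rwa [bound_zero])
    bound_le := bound_le hdecay.le hrate hLinit
    le_bound_zero := by
      rw [bound_zero, initBound]
      linarith
    bound_le_succ := fun t => by
      convert bound_le_succ_add hdecay.le hrate hLinf0 hLinit t using 2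
      rw [initBound]
      field_simp
    exists_limit := ⟨Linf, hLinf, tendsto_bound hdecay hrate⟩ }

end IsPopulation

lemma exists_deterministic_constants {M γ c₀ η cB₁ cB₂ : ℝ} (hM : 0 < M) (hγ : 0 < γ)
    (hc₀ : c₀ < 1) (hη : 0 < η) (hηM : η * M ≤ 1) (hcB₁ : 0 < cB₁) (hcB₂ : 0 < cB₂) :
    ∃ ψ₁ : ℝ, 0 < ψ₁ ∧ ∀ c₂ : ℝ, 0 < c₂ → ∃ τ₀ : ℝ, 0 < τ₀ ∧ ∀ τ : ℝ, τ₀ ≤ τ →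
      ∃ ψ₂ ε₀ : ℝ, 0 < ψ₂ ∧ 0 < ε₀ ∧
      ∀ {p D n : ℕ} {blk : Fin p → Fin D} {S : Matrix (Fin p) (Fin p) ℝ} {ξ : ℕ → Vec p}
        {C Linf : ℝ} {x : Fin n → Vec p} {b : ℕ → Vec p},
        IsPopulation blk S ξ M γ C → 2 ≤ p → 0 < n → √(rate (l0 (ξ 1)) p n) ≤ ε₀ →
        0 ≤ Linf → Linf ≤ l1 (ξ 1) → IsConcentrated x S (l0 (ξ 1)) →
        IsRun blk x η (bound cB₁ cB₂ η Linf (l0 (ξ 1)) p n) b →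
        b 0 ∈ feasible p (initBound cB₁ (l0 (ξ 1))) → discrepancy (ξ 1) (b 0) ≤ ψ₁ →
        ∃ T ≤ lastIter M γ c₀ cB₁ cB₂ η Linf (l1 (ξ 1)) (l0 (ξ 1)) p n, ∀ t,
          penalized blk x τ (corr blk S ξ 1) c₂ (initBound cB₁ (l0 (ξ 1))) (b T) ≤
            penalized blk x τ (corr blk S ξ 1) c₂ (initBound cB₁ (l0 (ξ 1))) (b t) →
          discrepancy (ξ 1) (b t) ≤ ψ₂ * rate (l0 (ξ 1)) p n := by
  have hC : 0 < recenteringConst M (1 + cB₁) := by unfold recenteringConst; positivity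
  obtain ⟨c, hc, hsel⟩ := exists_selection_constants hM hγ hη hηM
    (le_add_of_nonneg_right hcB₁.le : 1 ≤ 1 + cB₁)
  refine ⟨c * cB₁ ^ 2, by positivity, fun c₂ hc₂ =>
    ⟨recenteringConst M (1 + cB₁) * (44 * M), by positivity, fun τ hτ => ?_⟩⟩
  set thr := 4 * cB₂ * (1 + cB₁) / ((1 - c₀) * γ ^ 2 / M) with thr_def
  have : 0 < thr := by
    have := sub_pos.2 hc₀
    rw [thr_def]
    positivity
  obtain ⟨κ, e₀, hκ, he₀, hsel⟩ := hsel cB₁ (cB₂ * η * (1 + cB₁) / (44 * M)) (thr / (44 * M)) c₂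
    (τ / (44 * M)) hcB₁ (by positivity) hc₂ ((le_div_iff₀ (by positivity)).2 hτ)
  refine ⟨κ * (44 * M) ^ 2, min (e₀ / (44 * M)) (1 / (cB₂ * η)), by positivity, by positivity, ?_⟩
  intro p D n blk S ξ C Linf x b h hp hn hε hLinf0 hLinf hx hrun hb hδ
  have hρ : 0 < corr blk S ξ 1 := one_pos.trans_le (h.one_le_corr (by omega))
  have hs : 0 < √(l0 (ξ 1) : ℝ) := sqrt_l0_pos (h.isLeading hM hγ hp).norm_eq
  have hrate := rate_pos (h.l0_pos hM hγ hp) hp hn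
  have hdecay : cB₂ * η * √(rate (l0 (ξ 1)) p n) ≤ 1 :=
    (le_div_iff₀' (by positivity)).1 (hε.trans (min_le_right _ _))
  obtain ⟨T, hT, hopt⟩ := hsel (h.isPerturbedRun hM hγ hp hn hη hcB₁ hcB₂ hdecay hLinf0 hLinf hx
    hrun hb) ((le_div_iff₀' (by positivity)).1 (hε.trans (min_le_left _ _))) hδ
  rw [← mul_assoc, div_mul_cancel₀ _ (by positivity), mul_assoc, ← sqrt_sq_mul_eq] at hT
  rw [← mul_assoc, div_mul_cancel₀ _ (by positivity)] at hopt
  refine ⟨T, ?_, fun t ht => ?_⟩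
  · exact le_lastIter (by positivity) hdecay hLinf (by rw [sqrt_sq_mul_eq]; positivity) hT
  · rw [penalized_eq hs hρ.ne', penalized_eq hs hρ.ne', mul_le_mul_iff_right₀ hρ] at ht
    have := hopt t ht
    rwa [mul_pow, Real.sq_sqrt hrate.le, ← mul_assoc] at this

end Sample

section Asymptotics

variable {Ω : ℕ → Type*} [∀ n, MeasurableSpace (Ω n)] {P : ∀ n, Measure (Ω n)}
  [∀ n, IsProbabilityMeasure (P n)]

lemma tendsto_measure_one_of_diff_subset {A B C : ∀ n, Set (Ω n)}
    (hA : Tendsto (fun n => P n (A n)) atTop (𝓝 1)) (hB : Tendsto (fun n => P n (B n)) atTop (𝓝 0))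
    (h : ∀ᶠ n in atTop, A n \ B n ⊆ C n) : Tendsto (fun n => P n (C n)) atTop (𝓝 1) := by
  have hlow := ENNReal.Tendsto.sub hA hB (Or.inl ENNReal.one_ne_top)
  rw [tsub_zero] at hlow
  refine tendsto_of_tendsto_of_tendsto_of_le_of_le' hlow tendsto_const_nhds ?_
    (Eventually.of_forall fun n => prob_le_one)
  filter_upwards [h] with n hn
  exact le_measure_sdiff.trans (measure_mono hn)

lemma tendsto_measure_not_isConcentrated {p s : ℕ → ℕ}
    {S : ∀ n, Matrix (Fin (p n)) (Fin (p n)) ℝ} {X : ∀ n, Fin n → Ω n → Vec (p n)}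
    (hS : ∀ n, (S n).PosSemidef)
    (hX : ∀ n i, HasLaw (X n i) (multivariateGaussian 0 (S n)) (P n))
    (hind : ∀ n, iIndepFun (X n) (P n)) (hp : Tendsto p atTop atTop)
    (hs : ∀ᶠ n in atTop, 0 < s n) (hsp : ∀ n, s n ≤ p n)
    (hrate : Tendsto (fun n => √(rate (s n) (p n) n)) atTop (𝓝 0)) :
    Tendsto (fun n => P n {ω | ¬IsConcentrated (fun i => X n i ω) (S n) (s n)}) atTop (𝓝 0) := by
  have hreal : Tendsto (fun n => (P n).real {ω | ¬IsConcentrated (fun i => X n i ω) (S n) (s n)})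
      atTop (𝓝 0) := by
    refine tendsto_of_tendsto_of_tendsto_of_le_of_le' tendsto_const_nhds
      (tendsto_const_nhds.div_atTop (tendsto_natCast_atTop_atTop.comp hp) :
        Tendsto (fun n => 2 / (p n : ℝ)) atTop (𝓝 0))
      (Eventually.of_forall fun n => measureReal_nonneg) ?_
    filter_upwards [hs, hp.eventually_ge_atTop 2, eventually_gt_atTop 0,
      hrate.eventually_le_const (show (0 : ℝ) < 1 / 11 by norm_num)] with n hs hp hn hrate
    exact measureReal_not_isConcentrated_le (hS n) (hX n) (hind n) hn hs (hsp n) hp (by linarith)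
  exact (ENNReal.tendsto_toReal_zero_iff fun n => measure_ne_top _ _).1 hreal

end Asymptotics

end

end MsCCA

theorem theorem2_general
    (M γ c₀ η cB₁ cB₂ : ℝ) (hM : 0 < M) (hγ : 0 < γ) (hc₀ : c₀ < 1)
    (hη : 0 < η) (hηM : η * M ≤ 1) (hcB₁ : 0 < cB₁) (hcB₂ : 0 < cB₂) :
    ∃ ψ₁ : ℝ, 0 < ψ₁ ∧ ∀ c₂ : ℝ, 0 < c₂ → ∃ τ₀ : ℝ, 0 < τ₀ ∧ ∀ τ : ℝ, τ₀ ≤ τ →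
      ∃ ψ₂ : ℝ, 0 < ψ₂ ∧
      ∀ (p D s : ℕ → ℕ) (blk : ∀ n, Fin (p n) → Fin (D n))
        (S : ∀ n, Matrix (Fin (p n)) (Fin (p n)) ℝ) (ξ : ∀ n, ℕ → MsCCA.Vec (p n))
        (C : ℝ) (Linf : ℕ → ℝ),
        Tendsto p atTop atTop →
        (∀ n, MsCCA.IsPopulation (blk n) (S n) (ξ n) M γ C) →
        (∀ n, s n = MsCCA.l0 (ξ n 1)) →
        Tendsto (fun n => MsCCA.rate (s n) (p n) n) atTop (𝓝 0) →
        (∀ n, 0 ≤ Linf n ∧ Linf n ≤ MsCCA.l1 (ξ n 1)) →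
      ∀ (Ω : ℕ → Type*) [∀ n, MeasurableSpace (Ω n)] (P : ∀ n, Measure (Ω n))
        [∀ n, IsProbabilityMeasure (P n)] (X : ∀ n, Fin n → Ω n → MsCCA.Vec (p n)),
        (∀ n i, HasLaw (X n i) (multivariateGaussian 0 (S n)) (P n)) →
        (∀ n, iIndepFun (X n) (P n)) →
      ∀ β : ∀ n, ℕ → Ω n → MsCCA.Vec (p n),
        (∀ᶠ n in atTop, ∀ ω, MsCCA.IsRun (blk n) (fun i => X n i ω) η
          (MsCCA.bound cB₁ cB₂ η (Linf n) (s n) (p n) n) (fun t => β n t ω)) →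
        Tendsto (fun n => P n {ω | β n 0 ω ∈ MsCCA.feasible (p n) (MsCCA.initBound cB₁ (s n)) ∧
          MsCCA.discrepancy (ξ n 1) (β n 0 ω) ≤ ψ₁}) atTop (𝓝 1) →
      Tendsto (fun n => P n {ω | ∀ N : ℕ∞,
          (MsCCA.lastIter M γ c₀ cB₁ cB₂ η (Linf n) (MsCCA.l1 (ξ n 1)) (s n) (p n) n : ℕ∞) ≤ N →
          ∀ t : ℕ, (t : ℕ∞) ≤ N →
          (∀ t' : ℕ, (t' : ℕ∞) ≤ N →
            MsCCA.penalized (blk n) (fun i => X n i ω) τ (MsCCA.corr (blk n) (S n) (ξ n) 1) c₂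
              (MsCCA.initBound cB₁ (s n)) (β n t' ω) ≤
            MsCCA.penalized (blk n) (fun i => X n i ω) τ (MsCCA.corr (blk n) (S n) (ξ n) 1) c₂
              (MsCCA.initBound cB₁ (s n)) (β n t ω)) →
          MsCCA.discrepancy (ξ n 1) (β n t ω) ≤ ψ₂ * MsCCA.rate (s n) (p n) n}) atTop (𝓝 1) := by
  obtain ⟨ψ₁, hψ₁, hdet⟩ := MsCCA.exists_deterministic_constants hM hγ hc₀ hη hηM hcB₁ hcB₂
  refine ⟨ψ₁, hψ₁, fun c₂ hc₂ => ?_⟩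
  obtain ⟨τ₀, hτ₀, hdet⟩ := hdet c₂ hc₂
  refine ⟨τ₀, hτ₀, fun τ hτ => ?_⟩
  obtain ⟨ψ₂, ε₀, hψ₂, hε₀, hdet⟩ := hdet τ hτ
  refine ⟨ψ₂, hψ₂, ?_⟩
  intro p D s blk S ξ C Linf hp hpop hs hrate hLinf Ω _ P _ X hX hind β hrun hβ
  obtain rfl : s = fun n => MsCCA.l0 (ξ n 1) := funext hs
  have hsqrt : Tendsto (fun n => √(MsCCA.rate (MsCCA.l0 (ξ n 1)) (p n) n)) atTop (𝓝 0) := by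
    simpa using hrate.sqrt
  have hp2 := hp.eventually_ge_atTop 2
  refine MsCCA.tendsto_measure_one_of_diff_subset hβ
    (MsCCA.tendsto_measure_not_isConcentrated (fun n => (hpop n).posSemidef) hX hind hp
      (hp2.mono fun n => (hpop n).l0_pos hM hγ) (fun n => MsCCA.l0_le _) hsqrt) ?_
  filter_upwards [hrun, hsqrt.eventually_le_const hε₀, eventually_gt_atTop 0, hp2]
    with n hrun hε hn hp ω ⟨⟨hβ, hδ⟩, hx⟩ N hN t _ hmax
  obtain ⟨T, hT, hopt⟩ := hdet (hpop n) hp hn hε (hLinf n).1 (hLinf n).2 (not_not.1 hx) (hrun ω)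
    hβ hδ
  exact hopt t (hmax T ((Nat.cast_le.2 hT).trans hN))

theorem theorem2
    (M γ c₀ η cB₁ cB₂ : ℝ) (hM : 0 < M) (hγ : 0 < γ) (hc₀ : 0 < c₀) (hc₀' : c₀ < 1)
    (hη : 0 < η) (hη' : η ≤ (1 - c₀) / (2 * M * (M + 3))) (hcB₁ : 0 < cB₁) (hcB₂ : 0 < cB₂) :
    ∃ ψ₁ : ℝ, 0 < ψ₁ ∧ ∀ c₂ : ℝ, 0 < c₂ → ∃ τ₀ : ℝ, 0 < τ₀ ∧ ∀ τ : ℝ, τ₀ ≤ τ →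
      ∃ ψ₂ : ℝ, 0 < ψ₂ ∧
      -- the population model for each sample size `n`
      ∀ (p D s : ℕ → ℕ) (blk : ∀ n, Fin (p n) → Fin (D n))
        (S : ∀ n, Matrix (Fin (p n)) (Fin (p n)) ℝ) (ξ : ∀ n, ℕ → MsCCA.Vec (p n))
        (C : ℝ) (Linf : ℕ → ℝ),
        0 < C →
        Tendsto p atTop atTop →
        (∀ n, MsCCA.IsPopulation (blk n) (S n) (ξ n) M γ C) →
        (∀ n, s n = MsCCA.l0 (ξ n 1)) →
        Tendsto (fun n => MsCCA.rate (s n) (p n) n) atTop (𝓝 0) →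
        (∀ n, 1 ≤ Linf n ∧ Linf n ≤ MsCCA.l1 (ξ n 1)) →
      -- the data: `n` independent observations from `N(0, S n)`
      ∀ (Ω : ℕ → Type*) [∀ n, MeasurableSpace (Ω n)] (P : ∀ n, Measure (Ω n))
        [∀ n, IsProbabilityMeasure (P n)] (X : ∀ n, Fin n → Ω n → MsCCA.Vec (p n)),
        (∀ n i, HasLaw (X n i) (multivariateGaussian 0 (S n)) (P n)) →
        (∀ n, iIndepFun (X n) (P n)) →
      -- the iterates, with a possibly data-dependent initial guess
      ∀ β : ∀ n, ℕ → Ω n → MsCCA.Vec (p n),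
        (∀ n t, Measurable (β n t)) →
        (∀ᶠ n in atTop, ∀ ω, MsCCA.IsRun (blk n) (fun i => X n i ω) η
          (MsCCA.bound cB₁ cB₂ η (Linf n) (s n) (p n) n) (fun t => β n t ω)) →
        Tendsto (fun n => P n {ω | β n 0 ω ∈ MsCCA.feasible (p n) (MsCCA.initBound cB₁ (s n)) ∧
          MsCCA.discrepancy (ξ n 1) (β n 0 ω) ≤ ψ₁}) atTop (𝓝 1) →
      -- every maximizer of the penalized objective over the iterations `0, …, N`, for every
      -- `N ≥ T*`, and over all iterations (`N = ⊤`), has the optimal rate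
      Tendsto (fun n => P n {ω | ∀ N : ℕ∞,
          (MsCCA.lastIter M γ c₀ cB₁ cB₂ η (Linf n) (MsCCA.l1 (ξ n 1)) (s n) (p n) n : ℕ∞) ≤ N →
          ∀ t : ℕ, (t : ℕ∞) ≤ N →
          (∀ t' : ℕ, (t' : ℕ∞) ≤ N →
            MsCCA.penalized (blk n) (fun i => X n i ω) τ (MsCCA.corr (blk n) (S n) (ξ n) 1) c₂
              (MsCCA.initBound cB₁ (s n)) (β n t' ω) ≤
            MsCCA.penalized (blk n) (fun i => X n i ω) τ (MsCCA.corr (blk n) (S n) (ξ n) 1) c₂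
              (MsCCA.initBound cB₁ (s n)) (β n t ω)) →
          MsCCA.discrepancy (ξ n 1) (β n t ω) ≤ ψ₂ * MsCCA.rate (s n) (p n) n}) atTop (𝓝 1) := by
  have hηM : η * M ≤ 1 := by
    rw [le_div_iff₀ (by positivity)] at hη'
    nlinarith [mul_pos hη hM, mul_pos hM hM]
  obtain ⟨ψ₁, hψ₁, h⟩ := theorem2_general M γ c₀ η cB₁ cB₂ hM hγ hc₀' hη hηM hcB₁ hcB₂
  exact ⟨ψ₁, hψ₁, fun c₂ hc₂ => (h c₂ hc₂).imp fun τ₀ ⟨hτ₀, h⟩ => ⟨hτ₀, fun τ hτ =>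
    (h τ hτ).imp fun ψ₂ ⟨hψ₂, h⟩ => ⟨hψ₂, fun p D s blk S ξ C Linf _ hp hpop hs hrate hLinf =>
      fun Ω _ P _ X hX hind β _ => h p D s blk S ξ C Linf hp hpop hs hrate
        (fun n => ⟨zero_le_one.trans (hLinf n).1, (hLinf n).2⟩) Ω P X hX hind β⟩⟩⟩
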